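/- Let $d\ge 1$. Let $c\in C^\infty(\mathbb R^d)$ with $0<c_0\le c(x)\le C_0$ for all $x$. Let $W\subset\mathbb R^d$ be closed, strictly convex, balanced ($-W=W$), absorbing (every $y\in\mathbb R^d$ lies in $\tau W$ for some $\tau>0$), with $C^\infty$ boundary, and let $\Phi(p)=\max_{w\in W}\langle p,w\rangle$, the maximum being attained for every $p\in\mathbb R^d$. Put $H(x,p)=c(x)\Phi(p)$ and let $g:\mathbb R^d\to\mathbb R$, $t_0\in\mathbb R$. For $x,y\in\mathbb R^d$ let $\tilde d(x,y)$ be the infimum of the $t>0$ for which there is a $C^\infty$ curve $\gamma:[0,t]\to\mathbb R^d$ with $\gamma(0)=x$, $\gamma(t)=y$ and $\dot\gamma(s)\in c(\gamma(s))W$ for all $s\in[0,t]$. Assume that $(\mathbb R^d,\tilde d)$ is complete. Assume that the Lax formula, in its subdifferential version, holds for $H$ and $g$ up to time $t_0$: every continuous viscosity solution $\varphi$ on $\mathbb R^d\times[0,\infty)$ of $$\partial_t\varphi+H(x,\nabla_x\varphi)=0\ \text{ in }\mathbb R^d\times(0,\infty),\qquad \varphi(x,0)=g(x),$$ satisfies,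 for all $x\in\mathbb R^d$ and $0<t\le t_0$, $$\varphi(x,t)=\inf\Big\{g(\gamma(0))+\int_0^t\big(\langle p(s),\dot\gamma(s)\rangle-H(\gamma(s),p(s))\big)\,ds\Big\},$$ where the infimum is over all $v\in\mathbb R^d$ and all pairs of $C^\infty$ curves $(\gamma,p)$ on $[0,t]$ with $\dot\gamma(s)\in\partial_p^-H(\gamma(s),p(s))$, $\dot p(s)=-\partial_xH(\gamma(s),p(s))$, $\gamma(t)=x$, $p(t)=v$. Here $\partial_p^-$ is the Mordukhovich (limiting) subdifferential in $p$. Let $\varphi$ be such a viscosity solution, and let $x\in\mathbb R^d$ and $0<t\le t_0$. For $v\ne0$ consider the system $$\dot\gamma=-c(\gamma)\,\partial_p\Phi(p),\qquad \dot p=\partial_xc(\gamma)\,\Phi(p)\quad\text{on }[0,t],\qquad \gamma(0)=x,\quad p(0)=v .\tag{$*$}$$ Then, for every $v\neq0$, the system $(*)$ has a solution (with $\Phi$ differentiable along $p$); for every solution $(\gamma,p)$ of $(*)$ the minimum of $r\mapsto g(\gamma(r))$ over $[0,t]$ is attained; and $$\varphi(x,t)=\inf_{v\in\mathbb R^d\setminus\{0\}}\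 \min_{0\le r\le t}\big\{g(\gamma(x,v,r)):(\gamma(x,v,\cdot),p(x,v,\cdot))\text{ solves }(*)\big\}.$$ If $(*)$ has several solutions for some $v$, the infimum is taken over all of them. -/

import Mathlib

open Set Filter Topology
open scoped ContDiff Pointwise

/-- Euclidean space `ℝ^d`. -/
abbrev Euc (d : ℕ) : Type := EuclideanSpace ℝ (Fin d)

/-- Fréchet (regular) subdifferential of `f` at `x`:
`liminf_{y → x} (f y - f x - ⟨w, y - x⟩) / ‖y - x‖ ≥ 0`. -/
def frechetSubdiff {d : ℕ} (f : Euc d → ℝ) (x : Euc d) : Set (Euc d) :=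
  {w | ∀ ε > 0, ∀ᶠ y in 𝓝 x, f x + inner ℝ w (y - x) - ε * ‖y - x‖ ≤ f y}

/-- Mordukhovich (limiting) subdifferential of `f` at `x`. -/
def mordukhovichSubdiff {d : ℕ} (f : Euc d → ℝ) (x : Euc d) : Set (Euc d) :=
  {w | ∃ (u : ℕ → Euc d) (z : ℕ → Euc d),
    Tendsto u atTop (𝓝 x) ∧ Tendsto (fun n => f (u n)) atTop (𝓝 (f x)) ∧
    Tendsto z atTop (𝓝 w) ∧ ∀ n, z n ∈ frechetSubdiff f (u n)}

/-- `φ` is a (continuous) viscosity solution of `∂ₜφ + H(x, ∇ₓφ, t) = 0` on `ℝ^d × (0, ∞)` with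
`φ(x, 0) = g(x)`. Test functions `ψ` are `C¹` on space-time; only their germs at the touching
point matter. -/
structure IsViscositySolution {d : ℕ} (H : Euc d → Euc d → ℝ → ℝ) (g : Euc d → ℝ)
    (φ : Euc d → ℝ → ℝ) : Prop where
  continuousOn : ContinuousOn (fun z : Euc d × ℝ => φ z.1 z.2) (univ ×ˢ Ici 0)
  initial : ∀ x, φ x 0 = g x
  subsolution : ∀ ψ : Euc d × ℝ → ℝ, ContDiff ℝ 1 ψ → ∀ (x : Euc d) (t : ℝ), 0 < t →
    IsLocalMax (fun z : Euc d × ℝ => φ z.1 z.2 - ψ z) (x, t) →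
    deriv (fun s => ψ (x, s)) t + H x (gradient (fun y => ψ (y, t)) x) t ≤ 0
  supersolution : ∀ ψ : Euc d × ℝ → ℝ, ContDiff ℝ 1 ψ → ∀ (x : Euc d) (t : ℝ), 0 < t →
    IsLocalMin (fun z : Euc d × ℝ => φ z.1 z.2 - ψ z) (x, t) →
    0 ≤ deriv (fun s => ψ (x, s)) t + H x (gradient (fun y => ψ (y, t)) x) t

/-- A `C^∞` pair of curves `(γ, p)` on `[0, t]` which satisfies the bi-characteristic inclusion
`γ' ∈ ∂ₚ⁻H(γ, p, s)`, `p' = -∂ₓH(γ, p, s)` with terminal data `γ(t) = x`, `p(t) = v`. -/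
structure IsBicharacteristic {d : ℕ} (H : Euc d → Euc d → ℝ → ℝ) (t : ℝ) (x v : Euc d)
    (γ p : ℝ → Euc d) : Prop where
  smooth_state : ContDiffOn ℝ ∞ γ (Icc 0 t)
  smooth_costate : ContDiffOn ℝ ∞ p (Icc 0 t)
  state_mem : ∀ s ∈ Icc 0 t,
    derivWithin γ (Icc 0 t) s ∈ mordukhovichSubdiff (fun q => H (γ s) q s) (p s)
  costate_eq : ∀ s ∈ Icc 0 t,
    derivWithin p (Icc 0 t) s = -gradient (fun y => H y (p s) s) (γ s)
  state_final : γ t = x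
  costate_final : p t = v

/-- The values over which the (subdifferential) Lax formula minimizes:
`g(γ(0)) + ∫₀ᵗ (⟨p, γ'⟩ - H(γ, p, s)) ds`, for all `v` and all bi-characteristics `(γ, p)`. -/
def laxValues {d : ℕ} (H : Euc d → Euc d → ℝ → ℝ) (g : Euc d → ℝ) (x : Euc d) (t : ℝ) : Set ℝ :=
  {a | ∃ (v : Euc d) (γ p : ℝ → Euc d), IsBicharacteristic H t x v γ p ∧
    a = g (γ 0) +
      ∫ s in (0 : ℝ)..t, (inner ℝ (p s) (derivWithin γ (Icc 0 t) s) - H (γ s) (p s) s)}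

/-- The generalized Lax formula, in its subdifferential version, represents the viscosity solution
of the Cauchy problem with Hamiltonian `H` and initial datum `g` at all times `0 < t ≤ t₀`. -/
def LaxFormulaHolds {d : ℕ} (H : Euc d → Euc d → ℝ → ℝ) (g : Euc d → ℝ) (t₀ : ℝ) : Prop :=
  ∀ φ : Euc d → ℝ → ℝ, IsViscositySolution H g φ →
    ∀ (x : Euc d) (t : ℝ), 0 < t → t ≤ t₀ → IsGLB (laxValues H g x t) (φ x t)

/-- The boundary of `W` is a `C^∞` hypersurface, with `W` locally on one side of it. -/
def HasSmoothBoundary {d : ℕ} (W : Set (Euc d)) : Prop :=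
  ∀ x ∈ frontier W, ∃ (U : Set (Euc d)) (f : Euc d → ℝ), IsOpen U ∧ x ∈ U ∧
    ContDiffOn ℝ ∞ f U ∧ fderiv ℝ f x ≠ 0 ∧ W ∩ U = {y ∈ U | f y ≤ 0}

/-- The times `t > 0` in which a `C^∞` curve with `γ' ∈ c(γ) W` can go from `x` to `y`. -/
def travelTimes {d : ℕ} (c : Euc d → ℝ) (W : Set (Euc d)) (x y : Euc d) : Set ℝ :=
  {t | 0 < t ∧ ∃ γ : ℝ → Euc d, ContDiffOn ℝ ∞ γ (Icc 0 t) ∧ γ 0 = x ∧ γ t = y ∧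
    ∀ s ∈ Icc 0 t, derivWithin γ (Icc 0 t) s ∈ c (γ s) • W}

/-- The travel-time metric `d̃(x, y)`. -/
noncomputable def travelDist {d : ℕ} (c : Euc d → ℝ) (W : Set (Euc d)) (x y : Euc d) : ℝ :=
  sInf (travelTimes c W x y)

/-- `(ℝ^d, d̃)` is complete: every `d̃`-Cauchy sequence converges with respect to `d̃`. -/
def TravelDistComplete {d : ℕ} (c : Euc d → ℝ) (W : Set (Euc d)) : Prop :=
  ∀ u : ℕ → Euc d,
    (∀ ε > 0, ∃ N : ℕ, ∀ m ≥ N, ∀ n ≥ N, travelDist c W (u m) (u n) < ε) →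
    ∃ z : Euc d, Tendsto (fun n => travelDist c W (u n) z) atTop (𝓝 0)

/-- `(γ, p)` solves `γ' = -c(γ) ∂ₚΦ(p)`, `p' = ∂ₓc(γ) Φ(p)` on `[0, t]` with `γ(0) = x`,
`p(0) = v`; it is part of the definition that `∂ₚΦ` exists along the solution. -/
structure IsCharacteristic {d : ℕ} (c Φ : Euc d → ℝ) (t : ℝ) (x v : Euc d)
    (γ p : ℝ → Euc d) : Prop where
  differentiable : ∀ s ∈ Icc 0 t, DifferentiableAt ℝ Φ (p s)
  state_deriv : ∀ s ∈ Icc 0 t,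
    HasDerivWithinAt γ (-(c (γ s) • gradient Φ (p s))) (Icc 0 t) s
  costate_deriv : ∀ s ∈ Icc 0 t,
    HasDerivWithinAt p (Φ (p s) • gradient c (γ s)) (Icc 0 t) s
  state_init : γ 0 = x
  costate_init : p 0 = v

/-!
Write `N` for the set-valued velocity field `x ↦ c x • W`. Subgradients of `Φ` lie in `W` and obey
Euler's identity `⟨p, w⟩ = Φ p`, so the Lagrangian vanishes along every bi-characteristic, and a
value of the Lax formula is `g` at the initial point of a curve with velocity in `N` that ends at
`x`. Conversely every smooth curve with velocity in `N` is admissible there, with costate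
`p = 0`, because the subdifferential of `Φ` at the origin is `W`
(`exists_curve_of_mem_laxValues`, `mem_laxValues_of_contDiff`). Hence `φ x t` is the infimum of
`g` over the points which such curves join to `x` in time `t`.

*Characteristics give upper bounds.* `Φ` is only `C¹` away from the origin, so a characteristic is
only `C¹`, but its velocity lies in `N`. Approximating the velocity by smooth functions and slowing
down slightly yields smooth curves with velocity in `N` which join `x` in time `t` to points
arbitrarily close to a prescribed point of the characteristic (`exists_contDiff_curve_near`).

*Characteristics are dense in the reachable set.* Let `y` be reachable from `x` in time `t`. In the
control problem discretized by Euler polygons with step `t / n`, stop at the last step `k` at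
which the reachable set is still farther than `ε` from `y`, and minimize the distance to `y`
there. The discrete maximum principle (`exists_isEulerScheme_of_isMinOn`) turns a minimizer into an
Euler scheme of the characteristic system whose costate at step `k` has norm between `ε` and
`2 ε`. Such schemes stay in a compact set that avoids `p = 0`
(`IsEulerScheme.norm_costate_le`), where the characteristic system is continuous, and their
limit is a characteristic that passes within `2 ε` of `y`
(`exists_characteristic_of_eulerSchemes`). The stop before `y` is what keeps the costate away
from `0`; no existence or regularity theory for geodesics enters. The same compactness
argument, applied to explicit Euler schemes, proves that the characteristic system has solutions.
-/

/-! ### Support functions -/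

section Support

variable {d : ℕ} {W : Set (Euc d)} {Φ : Euc d → ℝ}

theorem inner_le_support (hΦ : ∀ p, IsGreatest ((fun w => inner ℝ p w) '' W) (Φ p))
    (p : Euc d) {w : Euc d} (hw : w ∈ W) : inner ℝ p w ≤ Φ p :=
  (hΦ p).2 ⟨w, hw, rfl⟩

theorem exists_inner_eq_support (hΦ : ∀ p, IsGreatest ((fun w => inner ℝ p w) '' W) (Φ p))
    (p : Euc d) : ∃ w ∈ W, inner ℝ p w = Φ p :=
  (hΦ p).1

/-- A set on which every linear functional attains a maximum is bounded. -/
theorem exists_norm_le_of_support (hΦ : ∀ p, IsGreatest ((fun w => inner ℝ p w) '' W) (Φ p)) :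
    ∃ M : ℝ, 0 < M ∧ ∀ w ∈ W, ‖w‖ ≤ M := by
  let e : Fin d → Euc d := fun i => EuclideanSpace.single i 1
  refine ⟨∑ i, max (Φ (e i)) (Φ (-e i)) + 1 + |∑ i, max (Φ (e i)) (Φ (-e i))|, ?_, ?_⟩
  · linarith [neg_abs_le (∑ i, max (Φ (e i)) (Φ (-e i)))]
  intro w hw
  have h1 : ‖w‖ ≤ ∑ i, |w i| := by
    have hsum : w = ∑ i, w i • e i := by
      have := (EuclideanSpace.basisFun (Fin d) ℝ).sum_repr w
      simpa [e] using this.symm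
    calc ‖w‖ = ‖∑ i, w i • e i‖ := by rw [← hsum]
      _ ≤ ∑ i, ‖w i • e i‖ := norm_sum_le _ _
      _ = ∑ i, |w i| := by simp [e, norm_smul]
  have h2 : ∀ i, |w i| ≤ max (Φ (e i)) (Φ (-e i)) := by
    intro i
    have a := inner_le_support hΦ (e i) hw
    have b := inner_le_support hΦ (-e i) hw
    simp only [e, inner_neg_left, EuclideanSpace.inner_single_left, map_one, one_mul] at a b
    exact abs_le'.2 ⟨a.trans (le_max_left _ _), b.trans (le_max_right _ _)⟩
  have h3 := Finset.sum_le_sum (fun i (_ : i ∈ Finset.univ) => h2 i)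
  linarith [abs_nonneg (∑ i, max (Φ (e i)) (Φ (-e i)))]

theorem isCompact_of_support (hW : IsClosed W)
    (hΦ : ∀ p, IsGreatest ((fun w => inner ℝ p w) '' W) (Φ p)) : IsCompact W := by
  obtain ⟨M, -, hM⟩ := exists_norm_le_of_support hΦ
  exact Metric.isCompact_of_isClosed_isBounded hW (isBounded_iff_forall_norm_le.2 ⟨M, hM⟩)

theorem support_sub_le (hΦ : ∀ p, IsGreatest ((fun w => inner ℝ p w) '' W) (Φ p))
    {M : ℝ} (hM : ∀ w ∈ W, ‖w‖ ≤ M) (p q : Euc d) : Φ p - Φ q ≤ M * ‖p - q‖ := by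
  obtain ⟨w, hw, hpw⟩ := exists_inner_eq_support hΦ p
  have h1 := inner_le_support hΦ q hw
  have h2 : inner ℝ (p - q) w ≤ ‖p - q‖ * ‖w‖ := real_inner_le_norm _ _
  rw [inner_sub_left] at h2
  nlinarith [hM w hw, norm_nonneg (p - q)]

theorem continuous_support (hΦ : ∀ p, IsGreatest ((fun w => inner ℝ p w) '' W) (Φ p)) :
    Continuous Φ := by
  obtain ⟨M, hM0, hM⟩ := exists_norm_le_of_support hΦ
  refine (LipschitzWith.of_dist_le_mul (K := ⟨M, hM0.le⟩) fun p q => ?_).continuous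
  rw [Real.dist_eq, dist_eq_norm]
  refine abs_le'.2 ⟨support_sub_le hΦ hM p q, ?_⟩
  rw [neg_sub, norm_sub_rev]
  exact support_sub_le hΦ hM q p

theorem support_zero (hΦ : ∀ p, IsGreatest ((fun w => inner ℝ p w) '' W) (Φ p)) : Φ 0 = 0 := by
  obtain ⟨w, -, hw⟩ := exists_inner_eq_support hΦ 0
  rw [← hw, inner_zero_left]

theorem support_smul (hΦ : ∀ p, IsGreatest ((fun w => inner ℝ p w) '' W) (Φ p))
    {a : ℝ} (ha : 0 ≤ a) (p : Euc d) : Φ (a • p) = a * Φ p := by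
  apply le_antisymm
  · obtain ⟨w, hw, h⟩ := exists_inner_eq_support hΦ (a • p)
    rw [← h, real_inner_smul_left]
    exact mul_le_mul_of_nonneg_left (inner_le_support hΦ p hw) ha
  · obtain ⟨w, hw, h⟩ := exists_inner_eq_support hΦ p
    rw [← h, ← real_inner_smul_left]
    exact inner_le_support hΦ _ hw

theorem support_neg (hWbal : -W = W)
    (hΦ : ∀ p, IsGreatest ((fun w => inner ℝ p w) '' W) (Φ p)) (p : Euc d) : Φ (-p) = Φ p := by
  have key : ∀ q, Φ (-q) ≤ Φ q := fun q => by
    obtain ⟨w, hw, h⟩ := exists_inner_eq_support hΦ (-q)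
    rw [← h, inner_neg_left, ← inner_neg_right]
    exact inner_le_support hΦ q (by rw [← hWbal]; simpa using hw)
  exact le_antisymm (key p) (by simpa using key (-p))

theorem support_pos (hWabs : ∀ y : Euc d, ∃ τ : ℝ, 0 < τ ∧ y ∈ τ • W)
    (hΦ : ∀ p, IsGreatest ((fun w => inner ℝ p w) '' W) (Φ p)) {p : Euc d} (hp : p ≠ 0) :
    0 < Φ p := by
  obtain ⟨τ, hτ, w, hw, hpw⟩ := hWabs p
  have h1 := inner_le_support hΦ p hw
  have h2 : inner ℝ p p = τ * inner ℝ p w := by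
    conv_lhs => rw [← hpw]
    rw [← hpw, real_inner_smul_right]
  have h3 : 0 < inner ℝ p p := real_inner_self_pos.2 hp
  rw [h2] at h3
  exact (pos_of_mul_pos_right h3 hτ.le).trans_le h1

theorem support_nonneg (hWabs : ∀ y : Euc d, ∃ τ : ℝ, 0 < τ ∧ y ∈ τ • W)
    (hΦ : ∀ p, IsGreatest ((fun w => inner ℝ p w) '' W) (Φ p)) (p : Euc d) : 0 ≤ Φ p := by
  rcases eq_or_ne p 0 with rfl | hp
  · exact (support_zero hΦ).ge
  · exact (support_pos hWabs hΦ hp).le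

theorem exists_mul_norm_le_support (hd : 0 < d)
    (hWabs : ∀ y : Euc d, ∃ τ : ℝ, 0 < τ ∧ y ∈ τ • W)
    (hΦ : ∀ p, IsGreatest ((fun w => inner ℝ p w) '' W) (Φ p)) :
    ∃ m : ℝ, 0 < m ∧ ∀ p, m * ‖p‖ ≤ Φ p := by
  have : Nonempty (Fin d) := ⟨⟨0, hd⟩⟩
  obtain ⟨q, hq, hmin⟩ := (isCompact_sphere (0 : Euc d) 1).exists_isMinOn
    (NormedSpace.sphere_nonempty.2 zero_le_one) (continuous_support hΦ).continuousOn
  have hq0 : q ≠ 0 := by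
    rintro rfl
    simp at hq
  refine ⟨Φ q, support_pos hWabs hΦ hq0, fun p => ?_⟩
  rcases eq_or_ne p 0 with rfl | hp
  · simp [support_zero hΦ]
  have hn : 0 < ‖p‖ := norm_pos_iff.2 hp
  have h1 : Φ q ≤ Φ (‖p‖⁻¹ • p) := hmin (by simp [norm_smul, hn.ne'])
  rw [support_smul hΦ (inv_nonneg.2 hn.le)] at h1
  calc Φ q * ‖p‖ ≤ ‖p‖⁻¹ * Φ p * ‖p‖ := mul_le_mul_of_nonneg_right h1 hn.le
    _ = Φ p := by field_simp

/-- A closed convex set is determined by its support function. -/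
theorem mem_of_inner_le_support (hW : IsClosed W) (hconv : Convex ℝ W)
    (hΦ : ∀ p, IsGreatest ((fun w => inner ℝ p w) '' W) (Φ p)) {w : Euc d}
    (h : ∀ p, inner ℝ p w ≤ Φ p) : w ∈ W := by
  by_contra hw
  obtain ⟨f, u, hf, hu⟩ := geometric_hahn_banach_closed_point hconv hW hw
  obtain ⟨v, hv, hvq⟩ := exists_inner_eq_support hΦ ((InnerProductSpace.toDual ℝ (Euc d)).symm f)
  have h1 := h ((InnerProductSpace.toDual ℝ (Euc d)).symm f)
  rw [← hvq, InnerProductSpace.toDual_symm_apply, InnerProductSpace.toDual_symm_apply] at h1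
  linarith [hf v hv]

theorem mem_smul_of_inner_le (hW : IsClosed W) (hconv : Convex ℝ W)
    (hΦ : ∀ p, IsGreatest ((fun w => inner ℝ p w) '' W) (Φ p)) {a : ℝ} (ha : 0 < a) {w : Euc d}
    (h : ∀ p, inner ℝ p w ≤ a * Φ p) : w ∈ a • W := by
  refine ⟨a⁻¹ • w, mem_of_inner_le_support hW hconv hΦ fun p => ?_, smul_inv_smul₀ ha.ne' w⟩
  rw [real_inner_smul_right, inv_mul_le_iff₀ ha]
  exact h p

/-- In a strictly convex set a nonzero linear functional has at most one maximizer. -/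
theorem support_maximizer_unique (hWconv : StrictConvex ℝ W)
    (hΦ : ∀ p, IsGreatest ((fun w => inner ℝ p w) '' W) (Φ p)) {p : Euc d} (hp : p ≠ 0)
    {w w' : Euc d} (hw : w ∈ W) (hw' : w' ∈ W) (h : inner ℝ p w = Φ p) (h' : inner ℝ p w' = Φ p) :
    w = w' := by
  by_contra hne
  have hmid : (1 / 2 : ℝ) • w + (1 / 2 : ℝ) • w' ∈ interior W :=
    hWconv hw hw' hne (by norm_num) (by norm_num) (by norm_num)
  set z := (1 / 2 : ℝ) • w + (1 / 2 : ℝ) • w' with hz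
  -- `z` is an interior point, so that one can still move in the direction `p` inside `W`.
  have hcont : Tendsto (fun s : ℝ => z + s • p) (𝓝[>] 0) (𝓝 z) := by
    have : Continuous fun s : ℝ => z + s • p := by fun_prop
    simpa using (this.tendsto 0).mono_left nhdsWithin_le_nhds
  have hev := (hcont.eventually (mem_interior_iff_mem_nhds.1 hmid)).and self_mem_nhdsWithin
  obtain ⟨s, hs, hs0⟩ := hev.exists
  have h1 := inner_le_support hΦ p hs
  have h2 : 0 < inner ℝ p p := real_inner_self_pos.2 hp
  simp only [hz, inner_add_right, real_inner_smul_right, h, h'] at h1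
  nlinarith [mul_pos (show (0 : ℝ) < s from hs0) h2]

/-- Upper semicontinuity of the set of maximizers; at `p ≠ 0` this set is a single point. -/
theorem exists_delta_maximizer_near (hW : IsClosed W) (hWconv : StrictConvex ℝ W)
    (hΦ : ∀ p, IsGreatest ((fun w => inner ℝ p w) '' W) (Φ p)) {p : Euc d} (hp : p ≠ 0)
    {w : Euc d} (hw : w ∈ W) (h : inner ℝ p w = Φ p) {ε : ℝ} (hε : 0 < ε) :
    ∃ δ > 0, ∀ q : Euc d, ‖q - p‖ < δ → ∀ u ∈ W, inner ℝ q u = Φ q → ‖u - w‖ < ε := by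
  by_contra! hcon
  choose q hq u huW hu hfar using fun n : ℕ => hcon (1 / ((n : ℝ) + 1)) (by positivity)
  have hqp : Tendsto q atTop (𝓝 p) := by
    rw [tendsto_iff_norm_sub_tendsto_zero]
    exact squeeze_zero (fun _ => norm_nonneg _) (fun n => (hq n).le)
      tendsto_one_div_add_atTop_nhds_zero_nat
  obtain ⟨u₀, hu₀, k, hk, hlim⟩ := (isCompact_of_support hW hΦ).tendsto_subseq huW
  have hqk := hqp.comp hk.tendsto_atTop
  have h1 : Tendsto (fun n => inner ℝ (q (k n)) (u (k n))) atTop (𝓝 (inner ℝ p u₀)) :=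
    hqk.inner hlim
  have h2 : Tendsto (fun n => inner ℝ (q (k n)) (u (k n))) atTop (𝓝 (Φ p)) := by
    simp only [hu]
    exact ((continuous_support hΦ).tendsto p).comp hqk
  have h3 := support_maximizer_unique hWconv hΦ hp hu₀ hw (tendsto_nhds_unique h1 h2) h
  have h4 : Tendsto (fun n => ‖u (k n) - w‖) atTop (𝓝 ‖u₀ - w‖) := (hlim.sub_const w).norm
  have h5 := ge_of_tendsto' h4 fun n => hfar (k n)
  simp [h3] at h5
  linarith

/-- The support function of a strictly convex set is differentiable away from the origin, and
its gradient is the maximizer. -/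
theorem hasGradientAt_support (hW : IsClosed W) (hWconv : StrictConvex ℝ W)
    (hΦ : ∀ p, IsGreatest ((fun w => inner ℝ p w) '' W) (Φ p)) {p : Euc d} (hp : p ≠ 0)
    {w : Euc d} (hw : w ∈ W) (h : inner ℝ p w = Φ p) : HasGradientAt Φ w p := by
  rw [hasGradientAt_iff_isLittleO, Asymptotics.isLittleO_iff]
  intro ε hε
  obtain ⟨δ, hδ, H⟩ := exists_delta_maximizer_near hW hWconv hΦ hp hw h hε
  filter_upwards [Metric.ball_mem_nhds p hδ] with q hq
  rw [Metric.mem_ball, dist_eq_norm] at hq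
  obtain ⟨u, hu, hqu⟩ := exists_inner_eq_support hΦ q
  have h1 := inner_le_support hΦ q hw
  have h2 := inner_le_support hΦ p hu
  have h3 : inner ℝ (u - w) (q - p) ≤ ‖u - w‖ * ‖q - p‖ := real_inner_le_norm _ _
  have h4 : ‖u - w‖ * ‖q - p‖ ≤ ε * ‖q - p‖ :=
    mul_le_mul_of_nonneg_right (H q hq u hu hqu).le (norm_nonneg _)
  simp only [inner_sub_left, inner_sub_right] at h3
  rw [Real.norm_eq_abs, abs_le]
  rw [inner_sub_right]
  rw [real_inner_comm q w, real_inner_comm p w, h]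
  rw [real_inner_comm q u, real_inner_comm p u, real_inner_comm q w, real_inner_comm p w] at h3
  constructor <;> nlinarith [mul_nonneg hε.le (norm_nonneg (q - p))]

theorem not_differentiableAt_support_zero (hd : 0 < d) (hWbal : -W = W)
    (hWabs : ∀ y : Euc d, ∃ τ : ℝ, 0 < τ ∧ y ∈ τ • W)
    (hΦ : ∀ p, IsGreatest ((fun w => inner ℝ p w) '' W) (Φ p)) : ¬ DifferentiableAt ℝ Φ 0 := by
  intro hdiff
  have hp : (EuclideanSpace.single ⟨0, hd⟩ 1 : Euc d) ≠ 0 := by simp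
  set p : Euc d := EuclideanSpace.single ⟨0, hd⟩ 1
  have habs : (fun s : ℝ => (Φ p)⁻¹ * Φ (s • p)) = abs := by
    funext s
    rcases le_total 0 s with hs | hs
    · rw [support_smul hΦ hs, abs_of_nonneg hs]
      field_simp [(support_pos hWabs hΦ hp).ne']
    · rw [← support_neg hWbal hΦ (s • p), ← neg_smul, support_smul hΦ (neg_nonneg.2 hs),
        abs_of_nonpos hs]
      field_simp [(support_pos hWabs hΦ hp).ne']
  refine not_differentiableAt_abs_zero ?_
  rw [← habs]
  have h0 : DifferentiableAt ℝ Φ ((0 : ℝ) • p) := by rwa [zero_smul]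
  exact (h0.comp (0 : ℝ) (by fun_prop : DifferentiableAt ℝ (fun s : ℝ => s • p) 0)).const_mul _

end Support

/-! ### Limits of discrete trajectories -/

section Limit

variable {E : Type*} [NormedAddCommGroup E] [NormedSpace ℝ E]

theorem norm_sub_sub_smul_le_of_increments {X : ℕ → E} {V : E} {η : ℝ} {a b : ℕ} (hab : a ≤ b)
    (h : ∀ j, a ≤ j → j < b → ‖X (j + 1) - X j - V‖ ≤ η) :
    ‖X b - X a - ((b : ℝ) - a) • V‖ ≤ ((b : ℝ) - a) * η := by
  induction b, hab using Nat.le_induction with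
  | base => simp
  | succ b hab ih =>
    have h1 := ih fun j hj hjb => h j hj (by omega)
    have h2 := h b hab (by omega)
    have h3 : X (b + 1) - X a - (((b + 1 : ℕ) : ℝ) - a) • V
        = (X b - X a - ((b : ℝ) - a) • V) + (X (b + 1) - X b - V) := by
      push_cast
      module
    rw [h3]
    refine (norm_add_le _ _).trans ?_
    push_cast
    linarith

theorem norm_sub_le_of_increments {X : ℕ → E} {η : ℝ} {a b : ℕ} (hab : a ≤ b)
    (h : ∀ j, a ≤ j → j < b → ‖X (j + 1) - X j‖ ≤ η) :
    ‖X b - X a‖ ≤ ((b : ℝ) - a) * η := by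
  simpa using norm_sub_sub_smul_le_of_increments (V := (0 : E)) hab (by simpa using h)

/-- Compactness of discrete trajectories: if `X k` takes `N k → ∞` steps of length `t / N k`
inside a compact set, with velocities that are bounded and consistent with the vector field `F`,
then along an ultrafilter the trajectories converge, as functions of time, to a solution of
`u' = F(u)`. The limit along an ultrafilter exists without extraction of a subsequence. -/
theorem exists_limit_of_discrete_trajectories {t : ℝ} (ht : 0 < t) {N : ℕ → ℕ}
    (hN : Tendsto N atTop atTop) (hN0 : ∀ k, 0 < N k) {X : ℕ → ℕ → E} {K : Set E}
    (hK : IsCompact K)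
    (hXK : ∀ k, ∀ i ≤ N k, X k i ∈ K) {M : ℝ} (hM : 0 < M)
    (hXM : ∀ k, ∀ i < N k, ‖X k (i + 1) - X k i‖ ≤ t / N k * M) (F : E → E)
    (hF : ∀ z ∈ K, ∀ ε > 0, ∃ δ > 0, ∀ᶠ k in (atTop : Filter ℕ), ∀ i < N k, ‖X k i - z‖ < δ →
      ‖X k (i + 1) - X k i - (t / N k) • F z‖ ≤ t / N k * ε)
    (κ : ℕ → ℕ) (hκ : ∀ k, κ k ≤ N k) :
    ∃ u : ℝ → E, (∀ s ∈ Icc 0 t, u s ∈ K) ∧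
      (∀ s ∈ Icc 0 t, HasDerivWithinAt u (F (u s)) (Icc 0 t) s) ∧
      Tendsto (fun k => X k 0) (hyperfilter ℕ) (𝓝 (u 0)) ∧
      ∃ r ∈ Icc 0 t, Tendsto (fun k => X k (κ k)) (hyperfilter ℕ) (𝓝 (u r)) := by
  have hle : (hyperfilter ℕ : Filter ℕ) ≤ atTop := Nat.hyperfilter_le_atTop
  have hNR : Tendsto (fun k => (N k : ℝ)) atTop atTop := tendsto_natCast_atTop_atTop.comp hN
  have hNpos : ∀ k, (0 : ℝ) < N k := fun k => Nat.cast_pos.2 (hN0 k)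
  have hstep : Tendsto (fun k => t / N k) atTop (𝓝 0) := hNR.const_div_atTop t
  -- `ι s k` is the index of the last grid point of the `k`-th trajectory up to time `s`.
  let ι : ℝ → ℕ → ℕ := fun s k => ⌊s * N k / t⌋₊
  have hι : ∀ s ∈ Icc 0 t, ∀ k, ι s k ≤ N k := fun s hs k => by
    refine Nat.floor_le_of_le ?_
    rw [div_le_iff₀ ht, mul_comm]
    exact mul_le_mul_of_nonneg_left hs.2 (hNpos k).le
  have hιmono : ∀ {s s'}, s ≤ s' → ∀ k, ι s k ≤ ι s' k := fun {s s'} h k =>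
    Nat.floor_le_floor (by have := hNpos k; gcongr)
  have hιlim : ∀ s ∈ Icc 0 t, Tendsto (fun k => (ι s k : ℝ) * (t / N k)) atTop (𝓝 s) := by
    intro s hs
    have hlow : Tendsto (fun k => s - t / N k) atTop (𝓝 s) := by simpa using hstep.const_sub s
    refine tendsto_of_tendsto_of_tendsto_of_le_of_le hlow tendsto_const_nhds (fun k => ?_)
      fun k => ?_
    · have h1 := Nat.lt_floor_add_one (s * N k / t)
      rw [div_lt_iff₀ ht] at h1
      have := hNpos k
      show s - t / N k ≤ (ι s k : ℝ) * (t / N k)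
      rw [← mul_div_assoc, sub_le_iff_le_add, ← add_div, le_div_iff₀ this]
      simp only [ι]
      linarith
    · have h1 := Nat.floor_le (show 0 ≤ s * N k / t from
        div_nonneg (mul_nonneg hs.1 (hNpos k).le) ht.le)
      rw [le_div_iff₀ ht] at h1
      have := hNpos k
      show (ι s k : ℝ) * (t / N k) ≤ s
      rw [← mul_div_assoc, div_le_iff₀ this]
      exact h1
  -- ultralimits of points on the trajectories
  have hlim : ∀ κ : ℕ → ℕ, (∀ k, κ k ≤ N k) →
      ∃ y ∈ K, Tendsto (fun k => X k (κ k)) (hyperfilter ℕ) (𝓝 y) := by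
    intro κ hκ
    obtain ⟨y, hy, h⟩ := hK.ultrafilter_le_nhds ((hyperfilter ℕ).map fun k => X k (κ k))
      (le_principal_iff.2 (Ultrafilter.mem_map.2 (univ_mem' fun k => hXK k _ (hκ k))))
    exact ⟨y, hy, h⟩
  have hex : ∀ s : ℝ, ∃ y, s ∈ Icc 0 t →
      y ∈ K ∧ Tendsto (fun k => X k (ι s k)) (hyperfilter ℕ) (𝓝 y) := fun s => by
    by_cases hs : s ∈ Icc 0 t
    · obtain ⟨y, hy⟩ := hlim (ι s) (hι s hs)
      exact ⟨y, fun _ => hy⟩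
    · exact ⟨0, fun h => absurd h hs⟩
  choose u hu using hex
  -- the limit is Lipschitz
  have hLip : ∀ a ∈ Icc 0 t, ∀ b ∈ Icc 0 t, a ≤ b → ‖u b - u a‖ ≤ (b - a) * M := by
    intro a ha b hb hab
    have h1 := (((hu b hb).2.sub (hu a ha).2).norm)
    have h2 : Tendsto (fun k => ((ι b k : ℝ) * (t / N k) - (ι a k : ℝ) * (t / N k)) * M)
        (hyperfilter ℕ) (𝓝 ((b - a) * M)) :=
      (((hιlim b hb).sub (hιlim a ha)).mul_const M).mono_left hle
    refine le_of_tendsto_of_tendsto' h1 h2 fun k => ?_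
    have := norm_sub_le_of_increments (X := X k) (hιmono hab k) (η := t / N k * M)
      fun j _ hj => hXM k j (hj.trans_le (hι b hb k))
    exact this.trans_eq (by ring)
  -- short pieces of the limit are nearly straight, with the velocity that `F` prescribes
  have hkey : ∀ z ∈ K, ∀ ε > 0, ∃ δ > 0, ∀ a ∈ Icc 0 t, ∀ b ∈ Icc 0 t, a ≤ b →
      ‖u a - z‖ + (b - a) * M < δ → ‖u b - u a - (b - a) • F z‖ ≤ (b - a) * ε := by
    intro z hz ε hε
    obtain ⟨δ, hδ, hev⟩ := hF z hz ε hε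
    refine ⟨δ, hδ, fun a ha b hb hab hclose => ?_⟩
    have hdiff : Tendsto (fun k => (ι b k : ℝ) * (t / N k) - (ι a k : ℝ) * (t / N k))
        (hyperfilter ℕ) (𝓝 (b - a)) := ((hιlim b hb).sub (hιlim a ha)).mono_left hle
    have h1 := ((((hu b hb).2.sub (hu a ha).2).sub (hdiff.smul_const (F z))).norm)
    refine le_of_tendsto_of_tendsto h1 (hdiff.mul_const ε) ?_
    have h3 : Tendsto (fun k => ‖X k (ι a k) - z‖ +
        ((ι b k : ℝ) * (t / N k) - (ι a k : ℝ) * (t / N k)) * M) (hyperfilter ℕ)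
        (𝓝 (‖u a - z‖ + (b - a) * M)) :=
      (((hu a ha).2.sub_const z).norm).add (hdiff.mul_const M)
    filter_upwards [h3.eventually (gt_mem_nhds hclose), hle hev] with k hk hevk
    have h4 := norm_sub_sub_smul_le_of_increments (X := X k) (hιmono hab k)
      (V := (t / N k) • F z) (η := t / N k * ε) fun j hja hjb => by
        have hjN : j < N k := hjb.trans_le (hι b hb k)
        refine hevk j hjN (lt_of_le_of_lt ?_ hk)
        have h5 := norm_sub_le_of_increments (X := X k) hja (η := t / N k * M)
          fun i _ hi => hXM k i (hi.trans hjN)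
        have h6 : ‖X k j - z‖ ≤ ‖X k (ι a k) - z‖ + ‖X k j - X k (ι a k)‖ := by
          rw [add_comm]
          exact norm_sub_le_norm_sub_add_norm_sub _ _ _
        have h7 : ((j : ℝ) - ι a k) * (t / N k * M) ≤ ((ι b k : ℝ) - ι a k) * (t / N k * M) := by
          have := hNpos k
          gcongr
        calc ‖X k j - z‖ ≤ ‖X k (ι a k) - z‖ + ((ι b k : ℝ) - ι a k) * (t / N k * M) := by
              linarith
          _ = _ := by ring
    rw [smul_smul, sub_mul] at h4
    exact h4.trans_eq (by ring)
  refine ⟨u, fun s hs => (hu s hs).1, fun s hs => ?_, ?_, ?_⟩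
  · rw [hasDerivWithinAt_iff_isLittleO, Asymptotics.isLittleO_iff]
    intro ε hε
    obtain ⟨δ, hδ, H⟩ := hkey (u s) (hu s hs).1 ε hε
    have hball : Metric.ball s (δ / (2 * M)) ∈ 𝓝[Icc 0 t] s :=
      mem_nhdsWithin_of_mem_nhds (Metric.ball_mem_nhds s (by positivity))
    filter_upwards [hball, self_mem_nhdsWithin] with r hr hrt
    rw [Metric.mem_ball, Real.dist_eq, lt_div_iff₀ (by positivity)] at hr
    rw [Real.norm_eq_abs]
    rcases le_total s r with hsr | hrs
    · rw [abs_of_nonneg (sub_nonneg.2 hsr)] at hr ⊢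
      rw [mul_comm ε]
      exact H s hs r hrt hsr (by
        rw [sub_self, norm_zero]
        nlinarith [mul_nonneg (sub_nonneg.2 hsr) hM.le])
    · rw [abs_of_nonpos (sub_nonpos.2 hrs), neg_sub] at hr ⊢
      have h1 := H r hrt s hs hrs (by
        rw [norm_sub_rev]
        linarith [hLip r hrt s hs hrs])
      rw [mul_comm ε, ← norm_neg]
      refine le_of_eq_of_le (congrArg _ ?_) h1
      module
  · have h0 : (0 : ℝ) ∈ Icc 0 t := ⟨le_rfl, ht.le⟩
    simpa [ι] using (hu 0 h0).2
  · -- the times `κ k * (t / N k)` have an ultralimit `r`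
    have hmem : ∀ k, (κ k : ℝ) * (t / N k) ∈ Icc 0 t := fun k => by
      have := hNpos k
      refine ⟨by positivity, ?_⟩
      rw [← mul_div_assoc, div_le_iff₀ this, mul_comm]
      exact mul_le_mul_of_nonneg_left (Nat.cast_le.2 (hκ k)) ht.le
    obtain ⟨r, hr, hrlim⟩ := isCompact_Icc.ultrafilter_le_nhds
      ((hyperfilter ℕ).map fun k => (κ k : ℝ) * (t / N k))
      (le_principal_iff.2 (Ultrafilter.mem_map.2 (univ_mem' hmem)))
    have hrlim : Tendsto (fun k => (κ k : ℝ) * (t / N k)) (hyperfilter ℕ) (𝓝 r) := hrlim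
    refine ⟨r, hr, ?_⟩
    have h1 : Tendsto (fun k => |(κ k : ℝ) * (t / N k) - (ι r k : ℝ) * (t / N k)| * M)
        (hyperfilter ℕ) (𝓝 0) := by
      have := ((hrlim.sub ((hιlim r hr).mono_left hle)).abs).mul_const M
      simpa using this
    have h2 : Tendsto (fun k => X k (κ k) - X k (ι r k)) (hyperfilter ℕ) (𝓝 0) := by
      refine squeeze_zero_norm (fun k => ?_) h1
      have hp := hNpos k
      rw [← sub_mul, abs_mul, abs_of_pos (div_pos ht hp)]
      rcases le_total (ι r k) (κ k) with h | h
      · rw [abs_of_nonneg (sub_nonneg.2 (Nat.cast_le.2 h))]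
        refine (norm_sub_le_of_increments (X := X k) h (η := t / N k * M)
          fun i _ hi => hXM k i (hi.trans_le (hκ k))).trans_eq (by ring)
      · rw [abs_of_nonpos (sub_nonpos.2 (Nat.cast_le.2 h)), neg_sub, norm_sub_rev]
        refine (norm_sub_le_of_increments (X := X k) h (η := t / N k * M)
          fun i _ hi => hXM k i (hi.trans_le (hι r hr k))).trans_eq (by ring)
    simpa using h2.add (hu r hr).2

end Limit

/-! ### Euler schemes for the characteristic system -/

section Scheme

variable {d : ℕ} {W : Set (Euc d)} {Φ c : Euc d → ℝ}

/-- `n` steps of length `h` of an Euler scheme for `γ' = -c(γ) ∂ₚΦ(p)`, `p' = ∂ₓc(γ) Φ(p)`.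
Here `w ∈ W` with `⟨Q, w⟩ = Φ Q` stands for `∂ₚΦ(Q)`. In each step the costate `Q` on the right-hand
side is either the old one (explicit step) or the new one (the step that the optimality
conditions of the discrete control problem produce). -/
def IsEulerScheme (W : Set (Euc d)) (Φ c : Euc d → ℝ) (h : ℝ) (n : ℕ) (X P : ℕ → Euc d) : Prop :=
  ∀ i < n, ∃ Q w : Euc d, (Q = P i ∨ Q = P (i + 1)) ∧ w ∈ W ∧ inner ℝ Q w = Φ Q ∧
    X (i + 1) = X i - (h * c (X i)) • w ∧ P (i + 1) = P i + (h * Φ Q) • gradient c (X i)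

theorem IsEulerScheme.extend (hΦ : ∀ p, IsGreatest ((fun w => inner ℝ p w) '' W) (Φ p)) {h : ℝ}
    {k n : ℕ} {X P : ℕ → Euc d} (hX : IsEulerScheme W Φ c h k X P) (hkn : k ≤ n) :
    ∃ X' P' : ℕ → Euc d, IsEulerScheme W Φ c h n X' P' ∧ ∀ i ≤ k, X' i = X i ∧ P' i = P i := by
  induction n, hkn using Nat.le_induction with
  | base => exact ⟨X, P, hX, fun _ _ => ⟨rfl, rfl⟩⟩
  | succ n hkn ih =>
    obtain ⟨X', P', hs, heq⟩ := ih
    obtain ⟨w, hw, hwΦ⟩ := exists_inner_eq_support hΦ (P' n)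
    refine ⟨Function.update X' (n + 1) (X' n - (h * c (X' n)) • w),
      Function.update P' (n + 1) (P' n + (h * Φ (P' n)) • gradient c (X' n)), ?_, ?_⟩
    · intro i hi
      rcases Nat.lt_succ_iff_lt_or_eq.1 hi with hi | rfl
      · obtain ⟨Q, u, hQ, h1⟩ := hs i hi
        refine ⟨Q, u, ?_, ?_⟩
        · rwa [Function.update_of_ne (by omega), Function.update_of_ne (by omega)]
        · rw [Function.update_of_ne (by omega), Function.update_of_ne (by omega),
            Function.update_of_ne (by omega), Function.update_of_ne (by omega)]
          exact h1
      · refine ⟨P' i, w, Or.inl ?_, hw, hwΦ, ?_, ?_⟩ <;> simp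
    · intro i hi
      rw [Function.update_of_ne (by omega), Function.update_of_ne (by omega)]
      exact heq i hi

theorem IsEulerScheme.norm_state_sub_le {h : ℝ} {n : ℕ} {X P : ℕ → Euc d} {M C₀ : ℝ}
    (hX : IsEulerScheme W Φ c h n X P) (hM : ∀ w ∈ W, ‖w‖ ≤ M) (hh : 0 ≤ h)
    (hc0 : ∀ y, 0 < c y) (hcC : ∀ y, c y ≤ C₀) :
    ∀ i < n, ‖X (i + 1) - X i‖ ≤ h * (C₀ * M) := by
  intro i hi
  obtain ⟨Q, w, -, hw, -, hXi, -⟩ := hX i hi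
  rw [hXi, sub_sub_cancel_left, norm_neg, norm_smul, Real.norm_eq_abs,
    abs_of_nonneg (mul_nonneg hh (hc0 _).le), mul_assoc]
  have h1 : 0 ≤ C₀ := (hc0 (X i)).le.trans (hcC _)
  exact mul_le_mul_of_nonneg_left (mul_le_mul (hcC _) (hM w hw) (norm_nonneg _) h1) hh

theorem continuous_gradient (hc : ContDiff ℝ ∞ c) : Continuous (gradient c) :=
  (InnerProductSpace.toDual ℝ (Euc d)).symm.continuous.comp (hc.continuous_fderiv (by simp))

theorem exists_norm_gradient_le (hc : ContDiff ℝ ∞ c) (x : Euc d) (R : ℝ) :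
    ∃ L : ℝ, 0 < L ∧ ∀ y ∈ Metric.closedBall x R, ‖gradient c y‖ ≤ L := by
  obtain ⟨L, hL⟩ := (isCompact_closedBall x R).exists_bound_of_continuousOn
    (continuous_gradient hc).continuousOn
  exact ⟨max L 1, by positivity, fun y hy => (hL y hy).trans (le_max_left _ _)⟩

/-- A nonnegative sequence whose successive terms are comparable, in both directions. -/
theorem le_pow_mul_of_comparable {ρ : ℕ → ℝ} {b : ℝ} {n : ℕ} (hb : 1 ≤ b) (hρ : ∀ i, 0 ≤ ρ i)
    (h₁ : ∀ i < n, ρ (i + 1) ≤ b * ρ i) (h₂ : ∀ i < n, ρ i ≤ b * ρ (i + 1)) :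
    ∀ i ≤ n, ∀ j ≤ n, ρ j ≤ b ^ n * ρ i := by
  have hb0 : 0 ≤ b := zero_le_one.trans hb
  have key : ∀ i k, i + k ≤ n → ρ (i + k) ≤ b ^ k * ρ i ∧ ρ i ≤ b ^ k * ρ (i + k) := by
    intro i k
    induction k with
    | zero => simp
    | succ k ih =>
      intro hk
      obtain ⟨a1, a2⟩ := ih (by omega)
      have b1 := h₁ (i + k) (by omega)
      have b2 := h₂ (i + k) (by omega)
      constructor
      · calc ρ (i + (k + 1)) ≤ b * (b ^ k * ρ i) := b1.trans (mul_le_mul_of_nonneg_left a1 hb0)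
          _ = b ^ (k + 1) * ρ i := by ring
      · calc ρ i ≤ b ^ k * (b * ρ (i + k + 1)) :=
              a2.trans (mul_le_mul_of_nonneg_left b2 (pow_nonneg hb0 k))
          _ = b ^ (k + 1) * ρ (i + (k + 1)) := by ring_nf
  intro i hi j hj
  rcases le_total i j with h | h
  · obtain ⟨k, rfl⟩ := Nat.exists_eq_add_of_le h
    exact (key i k hj).1.trans (mul_le_mul_of_nonneg_right
      (pow_le_pow_right₀ hb (by omega)) (hρ i))
  · obtain ⟨k, rfl⟩ := Nat.exists_eq_add_of_le h
    exact (key j k hi).2.trans (mul_le_mul_of_nonneg_right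
      (pow_le_pow_right₀ hb (by omega)) (hρ _))

/-- The costates of a scheme with small steps neither blow up nor approach `0`. -/
theorem IsEulerScheme.norm_costate_le {t : ℝ} {n : ℕ} {X P : ℕ → Euc d} {M L : ℝ}
    (ht : 0 < t) (hn : 0 < n)
    (hX : IsEulerScheme W Φ c (t / n) n X P)
    (hWabs : ∀ y : Euc d, ∃ τ : ℝ, 0 < τ ∧ y ∈ τ • W)
    (hΦ : ∀ p, IsGreatest ((fun w => inner ℝ p w) '' W) (Φ p))
    (hM0 : 0 < M) (hM : ∀ w ∈ W, ‖w‖ ≤ M) (hL0 : 0 < L)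
    (hL : ∀ i ≤ n, ‖gradient c (X i)‖ ≤ L) (hsmall : t / n * (L * M) ≤ 1 / 2) :
    (∀ i ≤ n, ∀ j ≤ n, ‖P j‖ ≤ Real.exp (2 * (t * (L * M))) * ‖P i‖) ∧
    ∀ i < n, ‖P (i + 1) - P i‖ ≤ t / n * (L * M) * max ‖P i‖ ‖P (i + 1)‖ := by
  have hnR : (0 : ℝ) < n := Nat.cast_pos.2 hn
  set a := t / n * (L * M) with ha
  have ha0 : 0 ≤ a := by positivity
  have hstep : ∀ i < n, ‖P (i + 1) - P i‖ ≤ a * max ‖P i‖ ‖P (i + 1)‖ := by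
    intro i hi
    obtain ⟨Q, w, hQ, hw, hQw, -, hP⟩ := hX i hi
    have hQn : ‖Q‖ ≤ max ‖P i‖ ‖P (i + 1)‖ := by
      rcases hQ with rfl | rfl
      exacts [le_max_left _ _, le_max_right _ _]
    have hΦQ0 : 0 ≤ Φ Q := support_nonneg hWabs hΦ Q
    have hΦQ : Φ Q ≤ M * ‖Q‖ := by
      simpa [support_zero hΦ] using support_sub_le hΦ hM Q 0
    have hdiff : P (i + 1) - P i = (t / n * Φ Q) • gradient c (X i) := sub_eq_of_eq_add' hP
    rw [hdiff, norm_smul, Real.norm_eq_abs, abs_of_nonneg (by positivity)]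
    calc t / n * Φ Q * ‖gradient c (X i)‖ ≤ t / n * (M * max ‖P i‖ ‖P (i + 1)‖) * L := by
          gcongr
          · exact hΦQ.trans (by gcongr)
          · exact hL i hi.le
      _ = a * max ‖P i‖ ‖P (i + 1)‖ := by rw [ha]; ring
  refine ⟨?_, hstep⟩
  -- `1 / (1 - a) ≤ exp (2 a)` for `0 ≤ a ≤ 1 / 2`
  have hexp : 1 ≤ (1 - a) * Real.exp (2 * a) := by
    have := Real.add_one_le_exp (2 * a)
    nlinarith
  have hcmp : ∀ {r s : ℝ}, 0 ≤ r → 0 ≤ s → |r - s| ≤ a * max s r →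
      r ≤ Real.exp (2 * a) * s ∧ s ≤ Real.exp (2 * a) * r := by
    intro r s hr hs h
    have h1 := abs_le.1 h
    have hE := Real.exp_pos (2 * a)
    have hrs : (1 - a) * r ≤ s ∧ (1 - a) * s ≤ r := by
      rcases le_total s r with hsr | hsr
      · rw [max_eq_right hsr] at h1
        constructor <;> nlinarith [mul_nonneg ha0 hr, mul_nonneg ha0 hs]
      · rw [max_eq_left hsr] at h1
        constructor <;> nlinarith [mul_nonneg ha0 hr, mul_nonneg ha0 hs]
    constructor
    · nlinarith [mul_le_mul_of_nonneg_left hrs.1 hE.le, mul_le_mul_of_nonneg_right hexp hr]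
    · nlinarith [mul_le_mul_of_nonneg_left hrs.2 hE.le, mul_le_mul_of_nonneg_right hexp hs]
  have hcmp' := fun i (hi : i < n) => hcmp (norm_nonneg (P (i + 1))) (norm_nonneg (P i))
    ((abs_norm_sub_norm_le _ _).trans (hstep i hi))
  have hpow : Real.exp (2 * a) ^ n = Real.exp (2 * (t * (L * M))) := by
    rw [← Real.exp_nat_mul, ha]
    congr 1
    field_simp
  rw [← hpow]
  exact le_pow_mul_of_comparable (Real.one_le_exp (by positivity)) (fun i => norm_nonneg (P i))
    (fun i hi => (hcmp' i hi).1) fun i hi => (hcmp' i hi).2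

/-- Limits of Euler schemes are characteristics. The constraint `S` on the state at some marked
step and on the initial costate survives in the limit. -/
theorem exists_characteristic_of_eulerSchemes {C₀ t m₀ B₀ : ℝ} (hc : ContDiff ℝ ∞ c)
    (hc0 : ∀ y, 0 < c y) (hcC : ∀ y, c y ≤ C₀) (hW : IsClosed W) (hWconv : StrictConvex ℝ W)
    (hWabs : ∀ y : Euc d, ∃ τ : ℝ, 0 < τ ∧ y ∈ τ • W)
    (hΦ : ∀ p, IsGreatest ((fun w => inner ℝ p w) '' W) (Φ p)) (ht : 0 < t) (x : Euc d)
    (hm₀ : 0 < m₀) {S : Set (Euc d × Euc d)} (hS : IsClosed S)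
    (hsch : ∀ n₀ : ℕ, ∃ n ≥ n₀, ∃ X P : ℕ → Euc d, IsEulerScheme W Φ c (t / n) n X P ∧ X 0 = x ∧
      ∃ k ≤ n, m₀ ≤ ‖P k‖ ∧ ‖P k‖ ≤ B₀ ∧ (X k, P 0) ∈ S) :
    ∃ γ p : ℝ → Euc d, p 0 ≠ 0 ∧ IsCharacteristic c Φ t x (p 0) γ p ∧
      ∃ r ∈ Icc 0 t, (γ r, p 0) ∈ S := by
  obtain ⟨M, hM0, hM⟩ := exists_norm_le_of_support hΦ
  have hC0 : 0 < C₀ := (hc0 x).trans_le (hcC x)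
  obtain ⟨L, hL0, hL⟩ := exists_norm_gradient_le hc x (t * (C₀ * M))
  obtain ⟨N₀, hN₀⟩ := exists_nat_gt (t * (L * M) * 2)
  choose N hN X P hXP hX0 κ hκ hlo hhi hmem using fun k => hsch (k + N₀ + 1)
  have hNpos : ∀ k, 0 < N k := fun k => by have := hN k; omega
  have hNR : ∀ k, (0 : ℝ) < N k := fun k => Nat.cast_pos.2 (hNpos k)
  have hNtop : Tendsto N atTop atTop :=
    tendsto_atTop_mono (fun k => show k ≤ N k by have := hN k; omega) tendsto_id
  have hsmall : ∀ k, t / N k * (L * M) ≤ 1 / 2 := fun k => by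
    have h1 : (N₀ : ℝ) ≤ N k := Nat.cast_le.2 (by have := hN k; omega)
    rw [div_mul_eq_mul_div, div_le_iff₀ (hNR k)]
    linarith
  have hXstep := fun k => (hXP k).norm_state_sub_le hM (div_pos ht (hNR k)).le hc0 hcC
  have hXball : ∀ k, ∀ i ≤ N k, X k i ∈ Metric.closedBall x (t * (C₀ * M)) := by
    intro k i hi
    have h1 := norm_sub_le_of_increments (X := X k) (Nat.zero_le i)
      fun j _ hj => hXstep k j (hj.trans_le hi)
    rw [hX0] at h1
    rw [Metric.mem_closedBall, dist_eq_norm]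
    refine h1.trans ?_
    have h2 : (i : ℝ) * (t / N k) ≤ t := by
      rw [← mul_div_assoc, div_le_iff₀ (hNR k), mul_comm]
      exact mul_le_mul_of_nonneg_left (Nat.cast_le.2 hi) ht.le
    calc ((i : ℝ) - (0 : ℕ)) * (t / N k * (C₀ * M)) = (i : ℝ) * (t / N k) * (C₀ * M) := by
          push_cast
          ring
      _ ≤ t * (C₀ * M) := mul_le_mul_of_nonneg_right h2 (by positivity)
  set b := Real.exp (2 * (t * (L * M))) with hb
  have hbpos : 0 < b := Real.exp_pos _
  have hPall := fun k => (hXP k).norm_costate_le ht (hNpos k) hWabs hΦ hM0 hM hL0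
    (fun i hi => hL _ (hXball k i hi)) (hsmall k)
  have hPhi : ∀ k, ∀ i ≤ N k, ‖P k i‖ ≤ b * B₀ := fun k i hi =>
    ((hPall k).1 (κ k) (hκ k) i hi).trans (mul_le_mul_of_nonneg_left (hhi k) hbpos.le)
  have hPlo : ∀ k, ∀ i ≤ N k, m₀ / b ≤ ‖P k i‖ := fun k i hi => by
    rw [div_le_iff₀' hbpos]
    exact (hlo k).trans ((hPall k).1 i hi (κ k) (hκ k))
  have hB0 : 0 < B₀ := hm₀.trans_le ((hlo 0).trans (hhi 0))
  have hPstep : ∀ k, ∀ i < N k, ‖P k (i + 1) - P k i‖ ≤ t / N k * (L * M * (b * B₀)) := by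
    intro k i hi
    refine ((hPall k).2 i hi).trans ?_
    have := hNR k
    exact (mul_le_mul_of_nonneg_left (max_le (hPhi k i hi.le) (hPhi k (i + 1) hi))
      (by positivity)).trans_eq (by ring)
  -- the compact part of phase space in which all schemes live; it avoids `p = 0`
  let K : Set (Euc d × Euc d) := Metric.closedBall x (t * (C₀ * M)) ×ˢ
    (Metric.closedBall 0 (b * B₀) ∩ {p | m₀ / b ≤ ‖p‖})
  have hK : IsCompact K := (isCompact_closedBall _ _).prod
    ((isCompact_closedBall _ _).inter_right (isClosed_le continuous_const continuous_norm))
  have hKne : ∀ z ∈ K, z.2 ≠ 0 := fun z hz h => by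
    have h1 : m₀ / b ≤ ‖z.2‖ := hz.2.2
    rw [h, norm_zero] at h1
    exact absurd h1 (not_le.2 (by positivity))
  let F : Euc d × Euc d → Euc d × Euc d := fun z =>
    (-(c z.1 • gradient Φ z.2), Φ z.2 • gradient c z.1)
  let M' : ℝ := C₀ * M + L * M * (b * B₀)
  have hM' : 0 < M' := by positivity
  have hZstep : ∀ k, ∀ i < N k, ‖(X k (i + 1), P k (i + 1)) - (X k i, P k i)‖ ≤ t / N k * M' := by
    intro k i hi
    have hp := hNR k
    have e1 : t / N k * (C₀ * M) ≤ t / N k * M' :=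
      mul_le_mul_of_nonneg_left (le_add_of_nonneg_right (by positivity)) (by positivity)
    have e2 : t / N k * (L * M * (b * B₀)) ≤ t / N k * M' :=
      mul_le_mul_of_nonneg_left (le_add_of_nonneg_left (by positivity)) (by positivity)
    exact max_le ((hXstep k i hi).trans e1) ((hPstep k i hi).trans e2)
  have hF : ∀ z ∈ K, ∀ ε > 0, ∃ δ > 0, ∀ᶠ k in (atTop : Filter ℕ), ∀ i < N k,
      ‖(X k i, P k i) - z‖ < δ →
      ‖(X k (i + 1), P k (i + 1)) - (X k i, P k i) - (t / N k) • F z‖ ≤ t / N k * ε := by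
    rintro ⟨ξ, π⟩ hz ε hε
    have hπ : π ≠ 0 := hKne _ hz
    obtain ⟨ν, hν, hνΦ⟩ := exists_inner_eq_support hΦ π
    have hgrad : gradient Φ π = ν := (hasGradientAt_support hW hWconv hΦ hπ hν hνΦ).gradient
    let G : Euc d × Euc d × Euc d → Euc d × Euc d := fun z =>
      (-(c z.1 • z.2.2), Φ z.2.1 • gradient c z.1)
    have hG : Continuous G := by
      have h1 := hc.continuous
      have h2 := continuous_gradient hc
      have h3 := continuous_support hΦ
      fun_prop
    obtain ⟨δ₁, hδ₁, H₁⟩ := Metric.continuousAt_iff.1 (hG.continuousAt (x := (ξ, π, ν))) ε hε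
    obtain ⟨δ₂, hδ₂, H₂⟩ := exists_delta_maximizer_near hW hWconv hΦ hπ hν hνΦ hδ₁
    refine ⟨min δ₁ δ₂ / 2, by positivity, ?_⟩
    have hstep0 : Tendsto (fun k => t / N k * M') atTop (𝓝 0) := by
      simpa using ((tendsto_natCast_atTop_atTop.comp hNtop).const_div_atTop t).mul_const M'
    filter_upwards [hstep0.eventually (gt_mem_nhds (show 0 < min δ₁ δ₂ / 2 by positivity))]
      with k hk i hi hclose
    obtain ⟨Q, w, hQ, hw, hQw, hXi, hPi⟩ := hXP k i hi
    have hX1 : ‖X k i - ξ‖ < min δ₁ δ₂ / 2 := (norm_fst_le _).trans_lt hclose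
    have hP1 : ‖P k i - π‖ < min δ₁ δ₂ / 2 := (norm_snd_le _).trans_lt hclose
    have hQπ : ‖Q - π‖ < min δ₁ δ₂ := by
      rcases hQ with rfl | rfl
      · exact hP1.trans (half_lt_self (by positivity))
      · have h1 : ‖P k (i + 1) - P k i‖ < min δ₁ δ₂ / 2 :=
          ((norm_snd_le _).trans (hZstep k i hi)).trans_lt hk
        have h2 := norm_sub_le_norm_sub_add_norm_sub (P k (i + 1)) (P k i) π
        linarith
    have hwν := H₂ Q (hQπ.trans_le (min_le_right _ _)) w hw hQw
    have hdist : dist (X k i, Q, w) (ξ, π, ν) < δ₁ := by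
      rw [Prod.dist_eq, Prod.dist_eq, dist_eq_norm, dist_eq_norm, dist_eq_norm]
      refine max_lt ?_ (max_lt (hQπ.trans_le (min_le_left _ _)) hwν)
      exact hX1.trans ((half_lt_self (by positivity)).trans_le (min_le_left _ _))
    have hGdist := (H₁ hdist).le
    rw [dist_eq_norm] at hGdist
    have heq : (X k (i + 1), P k (i + 1)) - (X k i, P k i) - (t / N k) • F (ξ, π)
        = (t / N k) • (G (X k i, Q, w) - G (ξ, π, ν)) := by
      simp only [F, G, hgrad, hXi, hPi, Prod.mk_sub_mk, Prod.smul_mk, Prod.mk.injEq]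
      constructor <;> module
    have hp := hNR k
    rw [heq, norm_smul, Real.norm_eq_abs, abs_of_pos (by positivity)]
    exact mul_le_mul_of_nonneg_left hGdist (by positivity)
  obtain ⟨u, huK, hu, hu0, r, hr, hur⟩ := exists_limit_of_discrete_trajectories ht hNtop hNpos hK
    (X := fun k i => (X k i, P k i))
    (fun k i hi => ⟨hXball k i hi, by simpa using hPhi k i hi, hPlo k i hi⟩) hM' hZstep F hF κ hκ
  have h0 : (0 : ℝ) ∈ Icc 0 t := ⟨le_rfl, ht.le⟩
  have hfst := (continuous_fst.tendsto _).comp hu0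
  simp only [Function.comp_def, hX0] at hfst
  refine ⟨fun s => (u s).1, fun s => (u s).2, hKne _ (huK 0 h0), ⟨fun s hs => ?_, fun s hs => ?_,
    fun s hs => ?_, ?_, rfl⟩, r, hr, ?_⟩
  · obtain ⟨ν, hν, hνΦ⟩ := exists_inner_eq_support hΦ (u s).2
    exact (hasGradientAt_support hW hWconv hΦ (hKne _ (huK s hs)) hν hνΦ).differentiableAt
  · exact (hu s hs).fst
  · exact (hu s hs).snd
  · exact (tendsto_nhds_unique hfst tendsto_const_nhds)
  · exact hS.mem_of_tendsto (((continuous_fst.tendsto _).comp hur).prodMk_nhds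
      ((continuous_snd.tendsto _).comp hu0)) (Eventually.of_forall hmem)

/-- Peano existence on the whole interval `[0, t]` for the characteristic system, whose right-hand
side is only continuous. -/
theorem exists_characteristic {C₀ t : ℝ} (hc : ContDiff ℝ ∞ c)
    (hc0 : ∀ y, 0 < c y) (hcC : ∀ y, c y ≤ C₀) (hW : IsClosed W) (hWconv : StrictConvex ℝ W)
    (hWabs : ∀ y : Euc d, ∃ τ : ℝ, 0 < τ ∧ y ∈ τ • W)
    (hΦ : ∀ p, IsGreatest ((fun w => inner ℝ p w) '' W) (Φ p)) (ht : 0 < t) (x : Euc d)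
    {v : Euc d} (hv : v ≠ 0) : ∃ γ p : ℝ → Euc d, IsCharacteristic c Φ t x v γ p := by
  obtain ⟨γ, p, -, hγ, r, -, -, hpv⟩ := exists_characteristic_of_eulerSchemes (B₀ := ‖v‖) hc hc0 hcC
    hW hWconv hWabs hΦ ht x (norm_pos_iff.2 hv) (S := univ ×ˢ {v})
    (isClosed_univ.prod isClosed_singleton) fun n₀ => by
      obtain ⟨X, P, hXP, h0⟩ := IsEulerScheme.extend (c := c) (h := t / n₀) (k := 0)
        (X := fun _ => x) (P := fun _ => v) hΦ (fun i hi => absurd hi (Nat.not_lt_zero i))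
        (Nat.zero_le n₀)
      obtain ⟨hx, hP⟩ := h0 0 le_rfl
      exact ⟨n₀, le_rfl, X, P, hXP, hx, 0, Nat.zero_le _, by rw [hP], by rw [hP], mem_univ _, hP⟩
  have hpv : p 0 = v := hpv
  exact ⟨γ, p, hpv ▸ hγ⟩

end Scheme

/-! ### The discrete control problem -/

section Control

variable {d : ℕ} {W : Set (Euc d)} {Φ c : Euc d → ℝ}

/-- The Euler polygon with step `h` for the control system `γ' = c(γ) w`, `w ∈ W`, started at `x`
and steered by the sequence of controls `w`. -/
noncomputable def controlPath (c : Euc d → ℝ) (h : ℝ) (x : Euc d) (w : ℕ → Euc d) : ℕ → Euc d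
  | 0 => x
  | i + 1 => controlPath c h x w i + (h * c (controlPath c h x w i)) • w i

theorem controlPath_congr {h : ℝ} {x : Euc d} {w w' : ℕ → Euc d} {i : ℕ}
    (hw : ∀ j < i, w j = w' j) : controlPath c h x w i = controlPath c h x w' i := by
  induction i with
  | zero => rfl
  | succ i ih =>
    simp only [controlPath]
    rw [ih fun j hj => hw j (by omega), hw i (by omega)]

theorem continuous_controlPath (hc : Continuous c) (h : ℝ) (x : Euc d) (i : ℕ) :
    Continuous fun w => controlPath c h x w i := by
  induction i with
  | zero => exact continuous_const
  | succ i ih =>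
    simp only [controlPath]
    fun_prop

/-- Solvability of the discrete adjoint equation, backwards from step `k`. -/
theorem exists_discrete_costate (h : ℝ) (X w : ℕ → Euc d) (k : ℕ) (q : Euc d) :
    ∃ P : ℕ → Euc d, P k = q ∧
      ∀ i < k, P i = P (i + 1) + (h * inner ℝ (P (i + 1)) (w i)) • gradient c (X i) := by
  induction k generalizing q with
  | zero => exact ⟨fun _ => q, rfl, fun i hi => absurd hi (Nat.not_lt_zero i)⟩
  | succ k ih =>
    obtain ⟨P, hPk, hP⟩ := ih (q + (h * inner ℝ q (w k)) • gradient c (X k))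
    refine ⟨Function.update P (k + 1) q, by simp, fun i hi => ?_⟩
    rcases Nat.lt_succ_iff_lt_or_eq.1 hi with hi | rfl
    · rw [Function.update_of_ne (by omega), Function.update_of_ne (by omega)]
      exact hP i hi
    · simp [hPk]

/-- First variation of the Euler polygon when the `i`-th control moves in the direction `v`. The
adjoint equation makes the pairing of costate and variation independent of the step. -/
theorem exists_hasDerivAt_controlPath (hc : ContDiff ℝ ∞ c) {h : ℝ} {x : Euc d}
    {w P : ℕ → Euc d} {k : ℕ}
    (hP : ∀ i < k, P i = P (i + 1) +
      (h * inner ℝ (P (i + 1)) (w i)) • gradient c (controlPath c h x w i))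
    (v : Euc d) {i j : ℕ} (hij : i + 1 ≤ j) (hjk : j ≤ k) :
    ∃ D : Euc d, HasDerivAt
        (fun θ : ℝ => controlPath c h x (Function.update w i (w i + θ • v)) j) D 0 ∧
      inner ℝ (P j) D = h * c (controlPath c h x w i) * inner ℝ (P (i + 1)) v := by
  induction j, hij using Nat.le_induction with
  | base =>
    refine ⟨(h * c (controlPath c h x w i)) • v, ?_, by rw [real_inner_smul_right]⟩
    have heq : (fun θ : ℝ => controlPath c h x (Function.update w i (w i + θ • v)) (i + 1)) =
        fun θ => controlPath c h x w i + (h * c (controlPath c h x w i)) • (w i + θ • v) := by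
      funext θ
      have h1 : controlPath c h x (Function.update w i (w i + θ • v)) i = controlPath c h x w i :=
        controlPath_congr fun j hj => Function.update_of_ne hj.ne _ _
      simp only [controlPath, h1, Function.update_self]
    rw [heq]
    have h2 : HasDerivAt (fun θ : ℝ => w i + θ • v) v 0 := by
      simpa using ((hasDerivAt_id (0 : ℝ)).smul_const v).const_add (w i)
    simpa using (h2.const_smul (h * c (controlPath c h x w i))).const_add (controlPath c h x w i)
  | succ j hij ih =>
    obtain ⟨D, hD, hPD⟩ := ih (by omega)
    set X := controlPath c h x w with hX
    have hbase : controlPath c h x (Function.update w i (w i + (0 : ℝ) • v)) j = X j := by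
      simp [hX]
    have hcj : HasDerivAt
        (fun θ : ℝ => c (controlPath c h x (Function.update w i (w i + θ • v)) j))
        (inner ℝ (gradient c (X j)) D) 0 := by
      have h1 : HasGradientAt c (gradient c (X j)) (X j) :=
        (hc.differentiable (by simp) (X j)).hasGradientAt
      rw [← hbase] at h1
      have h2 := h1.hasFDerivAt.comp_hasDerivAt (0 : ℝ) hD
      rw [hbase] at h2
      simpa [Function.comp_def] using h2
    refine ⟨D + (h * inner ℝ (gradient c (X j)) D) • w j, ?_, ?_⟩
    · have heq : (fun θ : ℝ => controlPath c h x (Function.update w i (w i + θ • v)) (j + 1)) =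
          fun θ => controlPath c h x (Function.update w i (w i + θ • v)) j +
            (h * c (controlPath c h x (Function.update w i (w i + θ • v)) j)) • w j := by
        funext θ
        simp only [controlPath]
        rw [Function.update_of_ne (show j ≠ i by omega)]
      rw [heq]
      exact hD.add ((hcj.const_mul h).smul_const (w j))
    · rw [← hPD, hP j (by omega), inner_add_right, inner_add_left, real_inner_smul_right,
        real_inner_smul_left]
      ring

/-- Discrete maximum principle: if the controls `w` minimize the distance of the `k`-th point to
`y`, then the polygon and its costate form an Euler scheme for the characteristic system. -/
theorem exists_isEulerScheme_of_isMinOn (hc : ContDiff ℝ ∞ c) (hc0 : ∀ y, 0 < c y)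
    (hWconv : Convex ℝ W) (hWbal : -W = W)
    (hΦ : ∀ p, IsGreatest ((fun w => inner ℝ p w) '' W) (Φ p)) {h : ℝ} (hh : 0 < h)
    {x y : Euc d} {k : ℕ} {w : ℕ → Euc d} (hw : ∀ i, w i ∈ W)
    (hmin : ∀ w' : ℕ → Euc d, (∀ i, w' i ∈ W) →
      ‖controlPath c h x w k - y‖ ≤ ‖controlPath c h x w' k - y‖) :
    ∃ P : ℕ → Euc d, P k = controlPath c h x w k - y ∧
      IsEulerScheme W Φ c h k (controlPath c h x w) P := by
  obtain ⟨P, hPk, hP⟩ := exists_discrete_costate (c := c) h (controlPath c h x w) w k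
    (controlPath c h x w k - y)
  refine ⟨P, hPk, fun i hi => ?_⟩
  have hneg : ∀ {u : Euc d}, u ∈ W → -u ∈ W := fun {u} hu => by
    rw [← hWbal]
    simpa using hu
  -- the first-order condition at the minimum, in the direction `u - w i`
  have hfirst : ∀ u ∈ W, inner ℝ (P (i + 1)) (w i) ≤ inner ℝ (P (i + 1)) u := by
    intro u hu
    obtain ⟨D, hD, hPD⟩ := exists_hasDerivAt_controlPath hc hP (u - w i)
      (Nat.succ_le_of_lt hi) le_rfl
    have h1 := (hD.sub_const y).norm_sq
    have h0 : controlPath c h x (Function.update w i (w i + (0 : ℝ) • (u - w i))) k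
        = controlPath c h x w k := by simp
    have hnonneg : 0 ≤ 2 * inner ℝ (controlPath c h x w k - y) D := by
      have h2 := h1.hasDerivWithinAt (s := Ioi 0)
      rw [h0, hasDerivWithinAt_iff_tendsto_slope' (by simp)] at h2
      refine ge_of_tendsto h2 ?_
      filter_upwards [Ioc_mem_nhdsGT (zero_lt_one' ℝ)] with θ hθ
      rw [slope_def_field, h0, sub_zero]
      refine div_nonneg (sub_nonneg.2 (pow_le_pow_left₀ (norm_nonneg _) (hmin _ fun j => ?_) 2))
        hθ.1.le
      rcases eq_or_ne j i with rfl | hj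
      · rw [Function.update_self]
        exact hWconv.add_smul_sub_mem (hw j) hu ⟨hθ.1.le, hθ.2⟩
      · rw [Function.update_of_ne hj]
        exact hw j
    rw [← hPk, hPD, inner_sub_right] at hnonneg
    have h3 : 0 < h * c (controlPath c h x w i) := mul_pos hh (hc0 _)
    by_contra hlt
    have h4 := mul_pos h3 (sub_pos.2 (not_le.1 hlt))
    linarith
  have hΦP : Φ (P (i + 1)) = -inner ℝ (P (i + 1)) (w i) := by
    apply le_antisymm
    · obtain ⟨u, hu, huΦ⟩ := exists_inner_eq_support hΦ (P (i + 1))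
      have := hfirst (-u) (hneg hu)
      rw [inner_neg_right] at this
      linarith
    · rw [← inner_neg_right]
      exact inner_le_support hΦ _ (hneg (hw i))
  refine ⟨P (i + 1), -w i, Or.inr rfl, hneg (hw i), by rw [inner_neg_right, hΦP], ?_, ?_⟩
  · rw [smul_neg, sub_neg_eq_add, controlPath]
  · rw [hP i hi, hΦP]
    module

/-- A characteristic from `x` passes, within time `t`, close to every point `y` that the Euler
polygons of the control system approach in time `t`. -/
theorem exists_characteristic_near_of_controlPath {C₀ t : ℝ} (hc : ContDiff ℝ ∞ c)
    (hc0 : ∀ y, 0 < c y) (hcC : ∀ y, c y ≤ C₀) (hW : IsClosed W) (hWconv : StrictConvex ℝ W)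
    (hWbal : -W = W) (hWabs : ∀ y : Euc d, ∃ τ : ℝ, 0 < τ ∧ y ∈ τ • W)
    (hΦ : ∀ p, IsGreatest ((fun w => inner ℝ p w) '' W) (Φ p)) (ht : 0 < t) {x y : Euc d} {ε : ℝ}
    (hε : 0 < ε) (hxy : ε < ‖x - y‖)
    (hreach : ∀ᶠ n : ℕ in atTop, ∃ w : ℕ → Euc d, (∀ i, w i ∈ W) ∧
      ‖controlPath c (t / n) x w n - y‖ ≤ ε) :
    ∃ v : Euc d, v ≠ 0 ∧ ∃ γ p : ℝ → Euc d, IsCharacteristic c Φ t x v γ p ∧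
      ∃ r ∈ Icc 0 t, ‖γ r - y‖ ≤ 2 * ε := by
  obtain ⟨M, hM0, hM⟩ := exists_norm_le_of_support hΦ
  have hWc := isCompact_of_support hW hΦ
  obtain ⟨w₀, hw₀, -⟩ := exists_inner_eq_support hΦ (0 : Euc d)
  have hstep : Tendsto (fun n : ℕ => t / n * (C₀ * M)) atTop (𝓝 0) := by
    simpa using (tendsto_natCast_atTop_atTop.const_div_atTop t).mul_const (C₀ * M)
  obtain ⟨n₁, hn₁⟩ := eventually_atTop.1
    ((hreach.and (hstep.eventually (gt_mem_nhds hε))).and (eventually_gt_atTop 0))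
  obtain ⟨γ, p, hp, hγ, r, hr, hS⟩ := exists_characteristic_of_eulerSchemes (B₀ := 2 * ε) hc hc0
    hcC hW hWconv hWabs hΦ ht x hε (S := Metric.closedBall y (2 * ε) ×ˢ univ)
    (Metric.isClosed_closedBall.prod isClosed_univ) fun n₀ => by
      classical
      obtain ⟨⟨hn, hsmall⟩, hnpos⟩ := hn₁ (max n₀ n₁) (le_max_right _ _)
      set n := max n₀ n₁ with hn_def
      have hnR : (0 : ℝ) < n := Nat.cast_pos.2 hnpos
      set h := t / (n : ℝ) with hh
      have hh0 : 0 < h := div_pos ht hnR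
      -- `k + 1` is the first step at which the reachable set comes within `ε` of `y`
      have hex : ∃ k, ∃ w : ℕ → Euc d, (∀ i, w i ∈ W) ∧ ‖controlPath c h x w k - y‖ ≤ ε :=
        ⟨n, hn⟩
      have hfind0 : Nat.find hex ≠ 0 := fun h0 => by
        obtain ⟨w, -, hw⟩ := Nat.find_spec hex
        rw [h0] at hw
        exact absurd hw (not_le.2 hxy)
      obtain ⟨k, hk⟩ := Nat.exists_eq_succ_of_ne_zero hfind0
      have hkn : k ≤ n := by
        have := Nat.find_min' hex hn
        omega
      have hfar : ∀ w : ℕ → Euc d, (∀ i, w i ∈ W) → ε < ‖controlPath c h x w k - y‖ :=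
        fun w hw => by
          have := Nat.find_min hex (show k < Nat.find hex by omega)
          by_contra hcon
          exact this ⟨w, hw, not_lt.1 hcon⟩
      obtain ⟨w', hw', hw'y⟩ := Nat.find_spec hex
      rw [hk] at hw'y
      have hnear : ‖controlPath c h x w' k - y‖ ≤ 2 * ε := by
        have h1 : ‖controlPath c h x w' (k + 1) - controlPath c h x w' k‖ ≤ h * (C₀ * M) := by
          rw [controlPath, add_sub_cancel_left, norm_smul, Real.norm_eq_abs,
            abs_of_pos (mul_pos hh0 (hc0 _)), mul_assoc]
          have h2 : 0 ≤ C₀ := (hc0 x).le.trans (hcC x)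
          exact mul_le_mul_of_nonneg_left
            (mul_le_mul (hcC _) (hM _ (hw' k)) (norm_nonneg _) h2) hh0.le
        have h3 := norm_sub_le_norm_sub_add_norm_sub (controlPath c h x w' k)
          (controlPath c h x w' (k + 1)) y
        rw [norm_sub_rev (controlPath c h x w' k) (controlPath c h x w' (k + 1))] at h3
        linarith
      -- an optimal sequence of controls exists because `W` is compact
      obtain ⟨w, hwW, hwmin⟩ := (isCompact_univ_pi fun _ : ℕ => hWc).exists_isMinOn
        ⟨fun _ => w₀, fun _ _ => hw₀⟩ (f := fun w => ‖controlPath c h x w k - y‖)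
        ((continuous_controlPath hc.continuous h x k).sub continuous_const).norm.continuousOn
      have hwW' : ∀ i, w i ∈ W := fun i => hwW i (mem_univ i)
      have hmin : ∀ u : ℕ → Euc d, (∀ i, u i ∈ W) →
          ‖controlPath c h x w k - y‖ ≤ ‖controlPath c h x u k - y‖ :=
        fun u hu => hwmin fun i _ => hu i
      obtain ⟨P, hPk, hP⟩ := exists_isEulerScheme_of_isMinOn hc hc0 hWconv.convex hWbal hΦ hh0
        hwW' hmin
      obtain ⟨X', P', hXP', heq⟩ := hP.extend hΦ hkn
      obtain ⟨hXk, hPk'⟩ := heq k le_rfl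
      refine ⟨n, le_max_left _ _, X', P', hXP', (heq 0 (Nat.zero_le _)).1, k, hkn, ?_, ?_, ?_⟩
      · rw [hPk', hPk]
        exact (hfar w hwW').le
      · rw [hPk', hPk]
        exact (hmin w' hw').trans hnear
      · refine ⟨?_, mem_univ _⟩
        rw [mem_closedBall_iff_norm]
        show ‖X' k - y‖ ≤ _
        rw [hXk]
        exact (hmin w' hw').trans hnear
  refine ⟨p 0, hp, γ, p, hγ, r, hr, ?_⟩
  have h1 := hS.1
  rwa [mem_closedBall_iff_norm] at h1

/-- A curve with `γ' ∈ c(γ) W` that ends at `x`, run backwards from `x` at a speed slightly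
below the original one, is traced exactly by Euler polygons with admissible controls. -/
theorem eventually_exists_controlPath_near {c₀ t : ℝ} (hc : Continuous c) (hc₀ : 0 < c₀)
    (hcb : ∀ y, c₀ ≤ c y) (hW : IsClosed W) (hWconv : Convex ℝ W) (hWbal : -W = W)
    (hWabs : ∀ y : Euc d, ∃ τ : ℝ, 0 < τ ∧ y ∈ τ • W)
    (hΦ : ∀ p, IsGreatest ((fun w => inner ℝ p w) '' W) (Φ p)) (ht : 0 < t) {γ γ' : ℝ → Euc d}
    (hγ : ∀ s ∈ Icc 0 t, HasDerivWithinAt γ (γ' s) (Icc 0 t) s)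
    (hγW : ∀ s ∈ Icc 0 t, γ' s ∈ c (γ s) • W) {ε : ℝ} (hε : 0 < ε) :
    ∀ᶠ n : ℕ in atTop, ∃ w : ℕ → Euc d, (∀ i, w i ∈ W) ∧
      ‖controlPath c (t / n) (γ t) w n - γ 0‖ ≤ ε := by
  have hcont : ContinuousOn γ (Icc 0 t) := fun s hs => (hγ s hs).continuousWithinAt
  obtain ⟨w₀, hw₀, -⟩ := exists_inner_eq_support hΦ (0 : Euc d)
  -- the factor `lam < 1` by which the curve is slowed down
  obtain ⟨lam, hlam0, hlam1, hlamε⟩ : ∃ lam : ℝ, 0 < lam ∧ lam < 1 ∧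
      ‖γ (t - lam * t) - γ 0‖ ≤ ε := by
    have h1 : Tendsto (fun lam : ℝ => t - lam * t) (𝓝[<] 1) (𝓝[Icc 0 t] 0) := by
      refine tendsto_nhdsWithin_iff.2 ⟨?_, ?_⟩
      · have : Continuous fun lam : ℝ => t - lam * t := by fun_prop
        simpa using (this.tendsto 1).mono_left nhdsWithin_le_nhds
      · filter_upwards [Ioo_mem_nhdsLT (zero_lt_one' ℝ)] with l hl
        constructor <;> nlinarith [hl.1, hl.2]
    have h2 := (hcont 0 ⟨le_rfl, ht.le⟩).tendsto.comp h1
    have h3 := (h2.sub_const (γ 0)).norm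
    rw [sub_self, norm_zero] at h3
    obtain ⟨l, hl, hl'⟩ := ((h3.eventually (gt_mem_nhds hε)).and
      (Ioo_mem_nhdsLT (zero_lt_one' ℝ))).exists
    exact ⟨l, hl'.1, hl'.2, le_of_lt hl⟩
  have huc := isCompact_Icc.uniformContinuousOn_of_continuous (hc.comp_continuousOn hcont)
  obtain ⟨δ, hδ, hδc⟩ := Metric.uniformContinuousOn_iff.1 huc ((1 - lam) * c₀)
    (mul_pos (sub_pos.2 hlam1) hc₀)
  have hstep : Tendsto (fun n : ℕ => t / n) atTop (𝓝 0) :=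
    tendsto_natCast_atTop_atTop.const_div_atTop t
  filter_upwards [hstep.eventually (gt_mem_nhds hδ), eventually_gt_atTop 0] with n hn hnpos
  have hnR : (0 : ℝ) < n := Nat.cast_pos.2 hnpos
  set h := t / (n : ℝ) with hh
  have hh0 : 0 < h := div_pos ht hnR
  have hnh : (n : ℝ) * h = t := by
    rw [hh]
    field_simp
  let X : ℕ → Euc d := fun i => γ (t - lam * (i * h))
  have hmem : ∀ i ≤ n, t - lam * (i * h) ∈ Icc 0 t := fun i hi => by
    have h1 : (i : ℝ) * h ≤ t := by
      rw [← hnh]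
      exact mul_le_mul_of_nonneg_right (Nat.cast_le.2 hi) hh0.le
    have h2 : 0 ≤ (i : ℝ) * h := by positivity
    constructor <;> nlinarith
  have hctrl : ∀ i : ℕ, ∃ w ∈ W, i < n → X (i + 1) = X i + (h * c (X i)) • w := by
    intro i
    by_cases hi : i < n
    swap
    · exact ⟨w₀, hw₀, fun h => absurd h hi⟩
    set a := t - lam * ((i + 1 : ℕ) * h) with ha
    set b := t - lam * (i * h) with hb
    have hba : b - a = lam * h := by
      rw [ha, hb]
      push_cast
      ring
    have hab : a ≤ b := by nlinarith [mul_pos hlam0 hh0]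
    have haI : a ∈ Icc 0 t := hmem (i + 1) hi
    have hbI : b ∈ Icc 0 t := hmem i hi.le
    have hsub : Icc a b ⊆ Icc 0 t := Icc_subset_Icc haI.1 hbI.2
    have hpos : 0 < h * c (γ b) := mul_pos hh0 (hc₀.trans_le (hcb _))
    have hin : γ a - γ b ∈ (h * c (γ b)) • W := by
      refine mem_smul_of_inner_le hW hWconv hΦ hpos fun p => ?_
      have hΦ0 := support_nonneg hWabs hΦ p
      have hder : ∀ s ∈ Ioo a b,
          HasDerivAt (fun s => -(inner ℝ p (γ s) : ℝ)) (-(inner ℝ p (γ' s))) s := by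
        intro s hs
        have hsI : s ∈ Ioo 0 t := ⟨haI.1.trans_lt hs.1, hs.2.trans_le hbI.2⟩
        have h1 := (hγ s (Ioo_subset_Icc_self hsI)).hasDerivAt (Icc_mem_nhds hsI.1 hsI.2)
        simpa using ((hasDerivAt_const s p).inner ℝ h1).fun_neg
      have hmv := (convex_Icc a b).image_sub_le_mul_sub_of_deriv_le
        (f := fun s => -(inner ℝ p (γ s) : ℝ)) (C := c (γ b) / lam * Φ p)
        ((continuousOn_const.inner (hcont.mono hsub)).neg)
        (by
          rw [interior_Icc]
          exact fun s hs => (hder s hs).differentiableAt.differentiableWithinAt)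
        (by
          rw [interior_Icc]
          intro s hs
          have hsI := hsub (Ioo_subset_Icc_self hs)
          rw [(hder s hs).deriv]
          obtain ⟨w, hw, hws⟩ := hγW s hsI
          have hws : c (γ s) • w = γ' s := hws
          have h1 := inner_le_support hΦ (-p) hw
          rw [support_neg hWbal hΦ, inner_neg_left] at h1
          have h2 : c (γ s) ≤ c (γ b) / lam := by
            have h3 : dist s b < δ := by
              rw [Real.dist_eq, abs_sub_comm, abs_of_pos (sub_pos.2 hs.2)]
              nlinarith [hs.1]
            have h4 := (abs_lt.1 (Real.dist_eq _ _ ▸ hδc s hsI b hbI h3)).2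
            simp only [Function.comp_apply] at h4
            rw [le_div_iff₀ hlam0]
            nlinarith [hcb (γ b), hcb (γ s)]
          have h5 : 0 ≤ c (γ s) := hc₀.le.trans (hcb _)
          rw [← hws, real_inner_smul_right]
          nlinarith [mul_le_mul_of_nonneg_left h1 h5, mul_le_mul_of_nonneg_right h2 hΦ0])
        a ⟨le_rfl, hab⟩ b ⟨hab, le_rfl⟩ hab
      rw [hba] at hmv
      have h6 : c (γ b) / lam * Φ p * (lam * h) = h * c (γ b) * Φ p := by field_simp
      rw [inner_sub_right]
      linarith
    obtain ⟨w, hw, hwe⟩ := hin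
    have hwe : (h * c (γ b)) • w = γ a - γ b := hwe
    refine ⟨w, hw, fun _ => ?_⟩
    show γ a = γ b + (h * c (γ b)) • w
    rw [hwe]
    abel
  choose w hwW hw using hctrl
  have hpath : ∀ i ≤ n, controlPath c h (γ t) w i = X i := by
    intro i
    induction i with
    | zero => simp [controlPath, X]
    | succ i ih =>
      intro hi
      rw [controlPath, ih (by omega), hw i (by omega)]
  refine ⟨w, hwW, ?_⟩
  rw [hpath n le_rfl]
  show ‖γ (t - lam * (n * h)) - γ 0‖ ≤ ε
  rwa [hnh]

end Control

/-! ### Subdifferentials and the Lax formula -/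

section Lax

variable {d : ℕ} {W : Set (Euc d)} {Φ c : Euc d → ℝ}

/-- For a convex function a Fréchet subgradient is a subgradient of convex analysis. -/
theorem add_inner_le_of_mem_frechetSubdiff {f : Euc d → ℝ} (hf : ConvexOn ℝ univ f) {u z : Euc d}
    (hz : z ∈ frechetSubdiff f u) (y : Euc d) : f u + inner ℝ z (y - u) ≤ f y := by
  have key : ∀ ε > 0, f u + inner ℝ z (y - u) - ε * ‖y - u‖ ≤ f y := by
    intro ε hε
    have hlim : Tendsto (fun s : ℝ => u + s • (y - u)) (𝓝[>] 0) (𝓝 u) := by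
      have : Continuous fun s : ℝ => u + s • (y - u) := by fun_prop
      simpa using (this.tendsto 0).mono_left nhdsWithin_le_nhds
    obtain ⟨s, hs, hs0, hs1⟩ := ((hlim.eventually (hz ε hε)).and
      (Ioo_mem_nhdsGT (zero_lt_one' ℝ))).exists
    have hconv := hf.2 (mem_univ u) (mem_univ y) (sub_nonneg.2 hs1.le) hs0.le (by ring)
    have heq : (1 - s) • u + s • y = u + s • (y - u) := by module
    rw [heq, smul_eq_mul, smul_eq_mul] at hconv
    rw [add_sub_cancel_left, real_inner_smul_right, norm_smul, Real.norm_eq_abs,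
      abs_of_pos hs0] at hs
    by_contra hcon
    have := mul_pos hs0 (sub_pos.2 (not_le.1 hcon))
    linarith
  have hlim : Tendsto (fun ε : ℝ => f u + inner ℝ z (y - u) - ε * ‖y - u‖) (𝓝[>] 0)
      (𝓝 (f u + inner ℝ z (y - u))) := by
    have : Continuous fun ε : ℝ => f u + inner ℝ z (y - u) - ε * ‖y - u‖ := by fun_prop
    simpa using (this.tendsto 0).mono_left nhdsWithin_le_nhds
  exact le_of_tendsto hlim (by filter_upwards [self_mem_nhdsWithin] with ε hε using key ε hε)

theorem add_inner_le_of_mem_mordukhovichSubdiff {f : Euc d → ℝ} (hf : ConvexOn ℝ univ f)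
    {u z : Euc d} (hz : z ∈ mordukhovichSubdiff f u) (y : Euc d) :
    f u + inner ℝ z (y - u) ≤ f y := by
  obtain ⟨v, w, hv, hfv, hw, hmem⟩ := hz
  exact le_of_tendsto' (hfv.add (hw.inner (hv.const_sub y)))
    fun n => add_inner_le_of_mem_frechetSubdiff hf (hmem n) y

theorem convexOn_support (hΦ : ∀ p, IsGreatest ((fun w => inner ℝ p w) '' W) (Φ p)) :
    ConvexOn ℝ univ Φ := by
  refine ⟨convex_univ, fun p _ q _ a b ha hb _ => ?_⟩
  obtain ⟨w, hw, h⟩ := exists_inner_eq_support hΦ (a • p + b • q)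
  rw [← h, inner_add_left, real_inner_smul_left, real_inner_smul_left]
  exact add_le_add (mul_le_mul_of_nonneg_left (inner_le_support hΦ p hw) ha)
    (mul_le_mul_of_nonneg_left (inner_le_support hΦ q hw) hb)

/-- Subgradients of `a Φ` lie in `a W` and satisfy Euler's identity for homogeneous functions. -/
theorem inner_eq_of_mem_mordukhovichSubdiff_support
    (hΦ : ∀ p, IsGreatest ((fun w => inner ℝ p w) '' W) (Φ p)) {a : ℝ} (ha : 0 < a) {p z : Euc d}
    (hz : z ∈ mordukhovichSubdiff (fun q => a * Φ q) p) :
    inner ℝ p z = a * Φ p ∧ ∀ q, inner ℝ q z ≤ a * Φ q := by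
  have hsub := add_inner_le_of_mem_mordukhovichSubdiff
    (f := fun q => a * Φ q) ((convexOn_support hΦ).smul ha.le) hz
  have h0 := hsub 0
  have h2 := hsub ((2 : ℝ) • p)
  simp only [support_zero hΦ, support_smul hΦ zero_le_two, inner_sub_right, inner_zero_right,
    real_inner_smul_right] at h0 h2
  have heq : inner ℝ p z = a * Φ p := by rw [real_inner_comm]; linarith
  refine ⟨heq, fun q => ?_⟩
  have h1 := hsub q
  rw [inner_sub_right, real_inner_comm q z, real_inner_comm p z] at h1
  linarith

/-- Along a bi-characteristic the Lagrangian vanishes, so that a value of the Lax formula is the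
initial datum at the foot of a curve whose velocity is in `c(γ) W`. -/
theorem exists_curve_of_mem_laxValues (hc0 : ∀ y, 0 < c y) (hW : IsClosed W)
    (hWconv : Convex ℝ W) (hΦ : ∀ p, IsGreatest ((fun w => inner ℝ p w) '' W) (Φ p))
    {g : Euc d → ℝ} {x : Euc d} {t a : ℝ} (ht : 0 < t)
    (ha : a ∈ laxValues (fun x p _ => c x * Φ p) g x t) :
    ∃ γ γ' : ℝ → Euc d, (∀ s ∈ Icc 0 t, HasDerivWithinAt γ (γ' s) (Icc 0 t) s) ∧
      (∀ s ∈ Icc 0 t, γ' s ∈ c (γ s) • W) ∧ γ t = x ∧ a = g (γ 0) := by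
  obtain ⟨v, γ, p, h, rfl⟩ := ha
  have hsub := fun s hs => inner_eq_of_mem_mordukhovichSubdiff_support hΦ (hc0 _)
    (h.state_mem s hs)
  refine ⟨γ, derivWithin γ (Icc 0 t), fun s hs =>
    (h.smooth_state.differentiableOn (by simp) s hs).hasDerivWithinAt, fun s hs =>
    mem_smul_of_inner_le hW hWconv hΦ (hc0 _) (hsub s hs).2, h.state_final, ?_⟩
  rw [intervalIntegral.integral_congr (g := fun _ => (0 : ℝ)) fun s hs => ?_]
  · simp
  · rw [uIcc_of_le ht.le] at hs
    simp only
    rw [(hsub s hs).1, sub_self]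

/-- Every smooth curve with velocity in `c(γ) W` contributes to the Lax formula, with costate
`p = 0`: the subdifferential of `Φ` at the origin is the whole of `W`. -/
theorem mem_laxValues_of_contDiff (hc0 : ∀ y, 0 < c y)
    (hΦ : ∀ p, IsGreatest ((fun w => inner ℝ p w) '' W) (Φ p))
    {g : Euc d → ℝ} {x : Euc d} {t : ℝ} (ht : 0 < t) {γ : ℝ → Euc d} (hγ : ContDiff ℝ ∞ γ)
    (hγW : ∀ s ∈ Icc 0 t, deriv γ s ∈ c (γ s) • W) (hx : γ t = x) :
    g (γ 0) ∈ laxValues (fun x p _ => c x * Φ p) g x t := by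
  refine ⟨0, γ, fun _ => 0, ⟨hγ.contDiffOn, contDiffOn_const, fun s hs => ?_, fun s hs => ?_, hx,
    rfl⟩, by simp [support_zero hΦ]⟩
  · have hd : derivWithin γ (Icc 0 t) s = deriv γ s :=
      (hγ.differentiable (by simp) s).derivWithin (uniqueDiffOn_Icc ht s hs)
    rw [hd]
    obtain ⟨w, hw, hws⟩ := hγW s hs
    have hws : c (γ s) • w = deriv γ s := hws
    refine ⟨fun _ => 0, fun _ => deriv γ s, tendsto_const_nhds, tendsto_const_nhds,
      tendsto_const_nhds, fun _ ε hε => Eventually.of_forall fun q => ?_⟩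
    have h1 := mul_le_mul_of_nonneg_left (inner_le_support hΦ q hw) (hc0 (γ s)).le
    rw [real_inner_comm] at h1
    simp only [← hws, support_zero hΦ, sub_zero, real_inner_smul_right, real_inner_comm]
    nlinarith [mul_nonneg hε.le (norm_nonneg q)]
  · simp [support_zero hΦ, gradient]

end Lax

/-! ### Smooth approximation of admissible curves -/

section Smoothing

variable {d : ℕ} {W : Set (Euc d)} {Φ c : Euc d → ℝ}

theorem exists_contDiff_norm_sub_le {F : Type*} [NormedAddCommGroup F] [NormedSpace ℝ F]
    [CompleteSpace F] {t : ℝ} (ht : 0 ≤ t) {f : ℝ → F} (hf : ContinuousOn f (Icc 0 t))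
    {δ : ℝ} (hδ : 0 < δ) :
    ∃ q : ℝ → F, ContDiff ℝ ∞ q ∧ ∀ s ∈ Icc 0 t, ‖q s - f s‖ ≤ δ := by
  have huc : UniformContinuous (IccExtend ht ((Icc 0 t).domRestrict f)) :=
    (CompactSpace.uniformContinuous_of_continuous
      (continuousOn_iff_continuous_domRestrict.1 hf)).comp (LipschitzWith.projIcc ht).uniformContinuous
  obtain ⟨q, hq, hqf⟩ := huc.exists_contDiff_dist_le hδ
  refine ⟨q, hq, fun s hs => ?_⟩
  have h1 := (hqf s).le
  rwa [IccExtend_of_mem ht _ hs, dist_eq_norm] at h1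

/-- A `C¹` curve `γ` with velocity in `c(γ) W` can be replaced by a smooth one which runs backwards
from a point near `γ r` to `γ 0` in the full time `t`. A smooth approximation of the velocity may
leave `c(γ) W` by a small amount; the factor `lam < 1` compensates for this. -/
theorem exists_contDiff_curve_near (hd : 0 < d) {c₀ t : ℝ} (hc : Continuous c) (hc₀ : 0 < c₀)
    (hcb : ∀ y, c₀ ≤ c y) (hW : IsClosed W) (hWconv : Convex ℝ W) (hWbal : -W = W)
    (hWabs : ∀ y : Euc d, ∃ τ : ℝ, 0 < τ ∧ y ∈ τ • W)
    (hΦ : ∀ p, IsGreatest ((fun w => inner ℝ p w) '' W) (Φ p)) (ht : 0 < t) {γ γ' : ℝ → Euc d}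
    (hγ : ∀ s ∈ Icc 0 t, HasDerivWithinAt γ (γ' s) (Icc 0 t) s)
    (hγ'c : ContinuousOn γ' (Icc 0 t)) (hγW : ∀ s ∈ Icc 0 t, γ' s ∈ c (γ s) • W)
    {r : ℝ} (hr : r ∈ Icc 0 t) {ε : ℝ} (hε : 0 < ε) :
    ∃ ζ : ℝ → Euc d, ContDiff ℝ ∞ ζ ∧ ζ t = γ 0 ∧ ‖ζ 0 - γ r‖ ≤ ε ∧
      ∀ s ∈ Icc 0 t, deriv ζ s ∈ c (ζ s) • W := by
  have hcont : ContinuousOn γ (Icc 0 t) := fun s hs => (hγ s hs).continuousWithinAt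
  obtain ⟨m, hm, hmΦ⟩ := exists_mul_norm_le_support hd hWabs hΦ
  have h0t : (0 : ℝ) ∈ Icc 0 t := ⟨le_rfl, ht.le⟩
  obtain ⟨lam, hlam0, hlam1, hlamε⟩ : ∃ lam : ℝ, 0 < lam ∧ lam < 1 ∧
      ‖γ (lam * r) - γ r‖ ≤ ε / 2 := by
    have h1 : Tendsto (fun lam : ℝ => lam * r) (𝓝[<] 1) (𝓝[Icc 0 t] r) := by
      refine tendsto_nhdsWithin_iff.2 ⟨?_, ?_⟩
      · have : Continuous fun lam : ℝ => lam * r := by fun_prop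
        simpa using (this.tendsto 1).mono_left nhdsWithin_le_nhds
      · filter_upwards [Ioo_mem_nhdsLT (zero_lt_one' ℝ)] with l hl
        constructor <;> nlinarith [hl.1, hl.2, hr.1, hr.2]
    have h3 := (((hcont r hr).tendsto.comp h1).sub_const (γ r)).norm
    rw [sub_self, norm_zero] at h3
    obtain ⟨l, hl, hl'⟩ := ((h3.eventually (gt_mem_nhds (half_pos hε))).and
      (Ioo_mem_nhdsLT (zero_lt_one' ℝ))).exists
    exact ⟨l, hl'.1, hl'.2, le_of_lt hl⟩
  -- the slack `(1 - lam) c₀` is shared by the error of the velocity and the change of `c`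
  set σ := (1 - lam) * c₀ / 2 with hσ
  have hσ0 : 0 < σ := by
    have := sub_pos.2 hlam1
    positivity
  obtain ⟨δ₁, hδ₁, hδ₁c⟩ := Metric.mem_uniformity_dist.1
    ((isCompact_Icc.image_of_continuousOn hcont).uniformContinuousAt_of_continuousAt c
      (fun y _ => hc.continuousAt) (Metric.dist_mem_uniformity hσ0))
  obtain ⟨δ, hδ0, hδm, hδ1, hδε⟩ : ∃ δ : ℝ, 0 < δ ∧ δ ≤ m * σ ∧ δ * t < δ₁ ∧ δ * t ≤ ε / 2 := by
    refine ⟨min (m * σ) (min (δ₁ / (2 * t)) (ε / (2 * t))), by positivity, min_le_left _ _, ?_, ?_⟩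
    · have h1 : min (m * σ) (min (δ₁ / (2 * t)) (ε / (2 * t))) ≤ δ₁ / (2 * t) :=
        (min_le_right _ _).trans (min_le_left _ _)
      have h2 : δ₁ / (2 * t) * t = δ₁ / 2 := by field_simp
      linarith [mul_le_mul_of_nonneg_right h1 ht.le]
    · have h1 : min (m * σ) (min (δ₁ / (2 * t)) (ε / (2 * t))) ≤ ε / (2 * t) :=
        (min_le_right _ _).trans (min_le_right _ _)
      have h2 : ε / (2 * t) * t = ε / 2 := by field_simp
      linarith [mul_le_mul_of_nonneg_right h1 ht.le]
  obtain ⟨q, hq, hqγ⟩ := exists_contDiff_norm_sub_le ht.le hγ'c hδ0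
  let η : ℝ → Euc d := fun s => γ 0 + ∫ y in (0 : ℝ)..s, q y
  have hη' : ∀ s, HasDerivAt η (q s) s := fun s =>
    ((hq.continuous.integral_hasStrictDerivAt 0 s).hasDerivAt).const_add (γ 0)
  have hηsmooth : ContDiff ℝ ∞ η := by
    refine contDiff_infty_iff_deriv.2 ⟨fun s => (hη' s).differentiableAt, ?_⟩
    rwa [show deriv η = q from funext fun s => (hη' s).deriv]
  have hη0 : η 0 = γ 0 := by simp [η]
  have hηγ : ∀ s ∈ Icc 0 t, ‖η s - γ s‖ ≤ δ * t := by
    intro s hs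
    have h1 := Convex.norm_image_sub_le_of_norm_hasDerivWithin_le (f := fun s => η s - γ s)
      (fun y hy => (hη' y).hasDerivWithinAt.sub (hγ y hy)) hqγ (convex_Icc 0 t) h0t hs
    simp only [hη0, sub_self, sub_zero] at h1
    rw [Real.norm_eq_abs, abs_of_nonneg hs.1] at h1
    exact h1.trans (mul_le_mul_of_nonneg_left hs.2 hδ0.le)
  have hqη : ∀ s ∈ Icc 0 t, ∀ p, lam * inner ℝ p (q s) ≤ c (η s) * Φ p := by
    intro s hs p
    have hΦ0 := support_nonneg hWabs hΦ p
    obtain ⟨w, hw, hws⟩ := hγW s hs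
    have hws : c (γ s) • w = γ' s := hws
    have h1 : inner ℝ p (γ' s) ≤ c (γ s) * Φ p := by
      rw [← hws, real_inner_smul_right]
      exact mul_le_mul_of_nonneg_left (inner_le_support hΦ p hw) (hc₀.le.trans (hcb _))
    have h2 : inner ℝ p (q s - γ' s) ≤ σ * Φ p := by
      calc inner ℝ p (q s - γ' s) ≤ ‖p‖ * ‖q s - γ' s‖ := real_inner_le_norm _ _
        _ ≤ ‖p‖ * (m * σ) :=
          mul_le_mul_of_nonneg_left ((hqγ s hs).trans hδm) (norm_nonneg _)
        _ = σ * (m * ‖p‖) := by ring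
        _ ≤ σ * Φ p := mul_le_mul_of_nonneg_left (hmΦ p) hσ0.le
    rw [inner_sub_right] at h2
    have h3 : c (γ s) ≤ c (η s) + σ := by
      have hdist : dist (γ s) (η s) < δ₁ := by
        rw [dist_comm, dist_eq_norm]
        exact (hηγ s hs).trans_lt hδ1
      have h4 : dist (c (γ s)) (c (η s)) < σ := hδ₁c hdist (mem_image_of_mem γ hs)
      rw [Real.dist_eq] at h4
      linarith [(abs_lt.1 h4).2]
    have h5 : lam * (c (η s) + 2 * σ) ≤ c (η s) := by
      rw [hσ]
      nlinarith [mul_le_mul_of_nonneg_left (hcb (η s)) (sub_nonneg.2 hlam1.le),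
        mul_nonneg (sub_nonneg.2 hlam1.le) (mul_nonneg (sub_nonneg.2 hlam1.le) hc₀.le)]
    have h6 : inner ℝ p (q s) ≤ (c (η s) + 2 * σ) * Φ p := by
      nlinarith [mul_le_mul_of_nonneg_right h3 hΦ0]
    calc lam * inner ℝ p (q s) ≤ lam * ((c (η s) + 2 * σ) * Φ p) :=
          mul_le_mul_of_nonneg_left h6 hlam0.le
      _ = lam * (c (η s) + 2 * σ) * Φ p := by ring
      _ ≤ c (η s) * Φ p := mul_le_mul_of_nonneg_right h5 hΦ0
  have hrt0 : 0 ≤ r / t := div_nonneg hr.1 ht.le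
  have hrt1 : r / t ≤ 1 := (div_le_one ht).2 hr.2
  set ρ := lam * (r / t) with hρ
  have hρ0 : 0 ≤ ρ := mul_nonneg hlam0.le hrt0
  have hρ1 : ρ ≤ 1 := by nlinarith
  have hρt : ρ * t = lam * r := by
    rw [hρ]
    field_simp
  refine ⟨fun s => η (ρ * (t - s)), hηsmooth.comp (by fun_prop), by simp [hη0], ?_, fun s hs => ?_⟩
  · show ‖η (ρ * (t - 0)) - γ r‖ ≤ ε
    rw [sub_zero, hρt]
    have h1 := hηγ (lam * r) ⟨by nlinarith [hr.1], by nlinarith [hr.1, hr.2]⟩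
    have h2 := norm_sub_le_norm_sub_add_norm_sub (η (lam * r)) (γ (lam * r)) (γ r)
    linarith
  · have hmem : ρ * (t - s) ∈ Icc 0 t := by
      have := sub_nonneg.2 hs.2
      exact ⟨mul_nonneg hρ0 this, by nlinarith [hs.1]⟩
    have hin : HasDerivAt (fun s => ρ * (t - s)) (-ρ) s := by
      simpa using ((hasDerivAt_id s).const_sub t).const_mul ρ
    have hder : HasDerivAt (fun s => η (ρ * (t - s))) ((-ρ) • q (ρ * (t - s))) s :=
      (hη' _).scomp s hin
    rw [hder.deriv]
    refine mem_smul_of_inner_le hW hWconv hΦ (hc₀.trans_le (hcb _)) fun p => ?_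
    have h1 := hqη _ hmem (-p)
    rw [support_neg hWbal hΦ, inner_neg_left] at h1
    have h2 := support_nonneg hWabs hΦ p
    have h3 : 0 ≤ c (η (ρ * (t - s))) := hc₀.le.trans (hcb _)
    rw [real_inner_smul_right, hρ]
    have h4 := mul_le_mul_of_nonneg_left h1 hrt0
    have h5 := mul_le_mul_of_nonneg_right hrt1 (mul_nonneg h3 h2)
    linarith

end Smoothing

/-! ### The representation formula -/

section Representation

variable {d : ℕ} {W : Set (Euc d)} {Φ c : Euc d → ℝ}

theorem continuousAt_gradient_support (hW : IsClosed W) (hWconv : StrictConvex ℝ W)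
    (hΦ : ∀ p, IsGreatest ((fun w => inner ℝ p w) '' W) (Φ p)) {p : Euc d} (hp : p ≠ 0) :
    ContinuousAt (gradient Φ) p := by
  rw [Metric.continuousAt_iff]
  intro ε hε
  obtain ⟨w, hw, hwΦ⟩ := exists_inner_eq_support hΦ p
  obtain ⟨δ, hδ, H⟩ := exists_delta_maximizer_near hW hWconv hΦ hp hw hwΦ hε
  refine ⟨min δ ‖p‖, lt_min hδ (norm_pos_iff.2 hp), fun q hq => ?_⟩
  rw [dist_eq_norm] at hq
  have hq0 : q ≠ 0 := by
    rintro rfl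
    simp at hq
  obtain ⟨u, hu, huΦ⟩ := exists_inner_eq_support hΦ q
  rw [(hasGradientAt_support hW hWconv hΦ hp hw hwΦ).gradient,
    (hasGradientAt_support hW hWconv hΦ hq0 hu huΦ).gradient, dist_eq_norm]
  exact H q (hq.trans_le (min_le_left _ _)) u hu huΦ

theorem IsCharacteristic.continuousOn {t : ℝ} {x v : Euc d} {γ p : ℝ → Euc d}
    (h : IsCharacteristic c Φ t x v γ p) : ContinuousOn γ (Icc 0 t) :=
  fun s hs => (h.state_deriv s hs).continuousWithinAt

/-- The velocity of a characteristic is continuous and lies in `c(γ) W`. The costate cannot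
vanish, since `Φ` is not differentiable at the origin. -/
theorem IsCharacteristic.velocity (hd : 0 < d) (hc : Continuous c) (hW : IsClosed W)
    (hWconv : StrictConvex ℝ W) (hWbal : -W = W)
    (hWabs : ∀ y : Euc d, ∃ τ : ℝ, 0 < τ ∧ y ∈ τ • W)
    (hΦ : ∀ p, IsGreatest ((fun w => inner ℝ p w) '' W) (Φ p)) {t : ℝ} {x v : Euc d}
    {γ p : ℝ → Euc d} (h : IsCharacteristic c Φ t x v γ p) :
    ContinuousOn (fun s => -(c (γ s) • gradient Φ (p s))) (Icc 0 t) ∧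
      ∀ s ∈ Icc 0 t, -(c (γ s) • gradient Φ (p s)) ∈ c (γ s) • W := by
  have hne : ∀ s ∈ Icc 0 t, p s ≠ 0 := fun s hs h0 =>
    not_differentiableAt_support_zero hd hWbal hWabs hΦ (h0 ▸ h.differentiable s hs)
  have hp : ContinuousOn p (Icc 0 t) := fun s hs => (h.costate_deriv s hs).continuousWithinAt
  have hgrad : ContinuousOn (fun s => gradient Φ (p s)) (Icc 0 t) := fun s hs =>
    (continuousAt_gradient_support hW hWconv hΦ (hne s hs)).comp_continuousWithinAt (hp s hs)
  refine ⟨((hc.comp_continuousOn h.continuousOn).smul hgrad).neg, fun s hs => ?_⟩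
  obtain ⟨w, hw, hwΦ⟩ := exists_inner_eq_support hΦ (p s)
  rw [(hasGradientAt_support hW hWconv hΦ (hne s hs) hw hwΦ).gradient]
  exact ⟨-w, by rw [← hWbal]; simpa using hw, smul_neg _ _⟩

end Representation

theorem mainTheorem4 {d : ℕ} (hd : 0 < d)
    (c : Euc d → ℝ) (c₀ C₀ : ℝ) (hc : ContDiff ℝ ∞ c) (hc₀ : 0 < c₀)
    (hcb : ∀ x, c₀ ≤ c x ∧ c x ≤ C₀)
    (W : Set (Euc d)) (hWclosed : IsClosed W) (hWconv : StrictConvex ℝ W)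
    (hWbal : -W = W) (hWabs : ∀ y : Euc d, ∃ τ : ℝ, 0 < τ ∧ y ∈ τ • W)
    (hWsmooth : HasSmoothBoundary W)
    (Φ : Euc d → ℝ) (hΦ : ∀ p, IsGreatest ((fun w => inner ℝ p w) '' W) (Φ p))
    (hcomplete : TravelDistComplete c W)
    (g : Euc d → ℝ) (t₀ : ℝ)
    (hLax : LaxFormulaHolds (fun x p _ => c x * Φ p) g t₀)
    (φ : Euc d → ℝ → ℝ) (hφ : IsViscositySolution (fun x p _ => c x * Φ p) g φ)
    (x : Euc d) (t : ℝ) (ht : 0 < t) (htt₀ : t ≤ t₀) :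
    (∀ v : Euc d, v ≠ 0 → ∃ γ p : ℝ → Euc d, IsCharacteristic c Φ t x v γ p) ∧
    (∀ v : Euc d, v ≠ 0 → ∀ γ p : ℝ → Euc d, IsCharacteristic c Φ t x v γ p →
      ∃ m : ℝ, IsLeast ((fun r => g (γ r)) '' Icc 0 t) m) ∧
    IsGLB {m : ℝ | ∃ v : Euc d, v ≠ 0 ∧ ∃ γ p : ℝ → Euc d, IsCharacteristic c Φ t x v γ p ∧
      IsLeast ((fun r => g (γ r)) '' Icc 0 t) m} (φ x t) := by
  have hc0 : ∀ y, 0 < c y := fun y => hc₀.trans_le (hcb y).1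
  have hlax := hLax φ hφ x t ht htt₀
  have hg : Continuous g := by
    have h1 : Continuous fun y : Euc d => φ y 0 :=
      hφ.continuousOn.comp_continuous (f := fun y : Euc d => (y, (0 : ℝ))) (by fun_prop)
        fun y => ⟨mem_univ _, self_mem_Ici⟩
    simpa only [hφ.initial] using h1
  have hexists : ∀ v : Euc d, v ≠ 0 → ∃ γ p : ℝ → Euc d, IsCharacteristic c Φ t x v γ p :=
    fun v hv => exists_characteristic hc hc0 (fun y => (hcb y).2) hWclosed hWconv hWabs hΦ ht x hv
  have hleast : ∀ (v : Euc d) (γ p : ℝ → Euc d), IsCharacteristic c Φ t x v γ p →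
      ∃ m : ℝ, IsLeast ((fun r => g (γ r)) '' Icc 0 t) m := fun v γ p h =>
    (isCompact_Icc.image_of_continuousOn (hg.comp_continuousOn h.continuousOn)).exists_isLeast
      ((nonempty_Icc.2 ht.le).image _)
  refine ⟨hexists, fun v _ => hleast v, ?_, ?_⟩
  · rintro m ⟨v, -, γ, p, h, ⟨r, hr, rfl⟩, -⟩
    obtain ⟨hcont, hmem⟩ := h.velocity hd hc.continuous hWclosed hWconv hWbal hWabs hΦ
    choose ζ hζ hζt hζ0 hζW using fun n : ℕ => exists_contDiff_curve_near hd hc.continuous hc₀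
      (fun y => (hcb y).1) hWclosed hWconv.convex hWbal hWabs hΦ ht h.state_deriv hcont hmem hr
      (ε := 1 / ((n : ℝ) + 1)) (by positivity)
    have hlim : Tendsto (fun n => ζ n 0) atTop (𝓝 (γ r)) := by
      rw [tendsto_iff_norm_sub_tendsto_zero]
      exact squeeze_zero (fun _ => norm_nonneg _) hζ0 tendsto_one_div_add_atTop_nhds_zero_nat
    exact ge_of_tendsto' ((hg.tendsto _).comp hlim) fun n => hlax.1
      (mem_laxValues_of_contDiff hc0 hΦ ht (hζ n) (hζW n) ((hζt n).trans h.state_init))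
  · intro b hb
    refine hlax.2 fun a ha => ?_
    obtain ⟨γ, γ', hγ, hγW, hγt, rfl⟩ :=
      exists_curve_of_mem_laxValues hc0 hWclosed hWconv.convex hΦ ht ha
    have hbound : ∀ (v : Euc d) (γ p : ℝ → Euc d), v ≠ 0 → IsCharacteristic c Φ t x v γ p →
        ∀ r ∈ Icc 0 t, b ≤ g (γ r) := by
      intro v γ p hv h r hr
      obtain ⟨m, hm⟩ := hleast v γ p h
      exact (hb ⟨v, hv, γ, p, h, hm⟩).trans (hm.2 ⟨r, hr, rfl⟩)
    -- points of characteristics are dense near the foot `γ 0` of the given curve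
    have hnear : ∀ ε > 0, ∃ y, ‖y - γ 0‖ ≤ 2 * ε ∧ b ≤ g y := by
      intro ε hε
      rcases le_or_gt ‖x - γ 0‖ ε with hx | hx
      · have hv : (EuclideanSpace.single ⟨0, hd⟩ 1 : Euc d) ≠ 0 := by simp
        obtain ⟨γ₁, p₁, h₁⟩ := hexists _ hv
        have h2 := hbound _ γ₁ p₁ hv h₁ 0 ⟨le_rfl, ht.le⟩
        rw [h₁.state_init] at h2
        exact ⟨x, by linarith, h2⟩
      · have hreach := eventually_exists_controlPath_near hc.continuous hc₀ (fun y => (hcb y).1)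
          hWclosed hWconv.convex hWbal hWabs hΦ ht hγ hγW hε
        rw [hγt] at hreach
        obtain ⟨v, hv, γ₁, p₁, h₁, r, hr, hry⟩ := exists_characteristic_near_of_controlPath hc hc0
          (fun y => (hcb y).2) hWclosed hWconv hWbal hWabs hΦ ht hε hx hreach
        exact ⟨γ₁ r, hry, hbound v γ₁ p₁ hv h₁ r hr⟩
    choose y hy hby using fun n : ℕ => hnear (1 / ((n : ℝ) + 1)) (by positivity)
    have hlim : Tendsto y atTop (𝓝 (γ 0)) := by
      rw [tendsto_iff_norm_sub_tendsto_zero]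
      exact squeeze_zero (fun _ => norm_nonneg _) hy
        (by simpa using tendsto_one_div_add_atTop_nhds_zero_nat.const_mul (2 : ℝ))
    exact ge_of_tendsto' ((hg.tendsto _).comp hlim) hby
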